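/- **Model.** There are $N$ independent students and $p$ predictors, each either continuous or categorical with values $0,\dots,K_j$. For student $i$ the complete predictors are $Z_{ij}=F_j(Z^*_{ij})$, where $\mathbf Z^*_i\sim N(\mathbf 0,\boldsymbol\Sigma)$, $\boldsymbol\Sigma$ is a positive definite correlation matrix, and $F_j$ is $x\mapsto c_j+d_jx$ with $d_j>0$ (continuous) or maps $(c_{jk},c_{j,k+1}]$ to $k$ for strictly increasing cut points $c_{j1}<\dots<c_{jK_j}$, $c_{j0}=-\infty$, $c_{j,K_j+1}=\infty$ (categorical). The ability satisfies $\theta_i\mid \mathbf Z_i\sim N(\beta_0+\sum_j\boldsymbol\beta_j^\top g_j(Z_{ij}),\sigma^2)$, $\sigma^2>0$, where $g_j(z)=z$ for continuous $j$ and $g_j(z)=(\mathbb I\{z\ge1\},\dots,\mathbb I\{z\ge K_j\})^\top$ for categorical $j$. Given $\theta_i$ (and $\mathbf Z_i$), the responses $\mathbf Y_i=(Y_{il})_{l\in\mathcal B_i}$ to the assigned items are independent, $Y_{il}\in\{0,\dots,L_l\}$ following the generalised partial credit model $P(Y_{il}=k\mid\theta)\propto\exp\{\sum_{r=1}^k(a_l\theta+b_{lr})\}$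 with known item parameters (the two-parameter logistic model if $L_l=1$). The null predictors are those with $\boldsymbol\beta_j=\mathbf 0$; $\mathcal S^*$ is the set of the others. Let $\mathcal A_i\subset\{1,\dots,p\}$ be the random set of observed predictors of student $i$, $\mathbf Z_i^{\rm obs}=(Z_{ij})_{j\in\mathcal A_i}$ and $\mathbf Z^{\rm obs}_{i,-j}=(Z_{ik})_{k\in\mathcal A_i\setminus\{j\}}$. Given $\mathbf Z_i$, $\mathcal A_i$ is independent of $\mathbf Y_i$ and has a conditional probability mass function $q_i(\boldsymbol\alpha\mid\mathbf z)$ that depends on $\mathbf z$ only through $(z_k)_{k\in\boldsymbol\alpha\cap\mathcal S^*}$ (SMAR). Let $\mathbb P$ denote this model with the true parameters, and $\mathbb Q$ the model of the same form with fixed plug-in parameters $\hat{\boldsymbol\Sigma},\hat F_j,\hat\beta_0,\hat{\boldsymbol\beta}_j,\hat\sigma^2$ (same items). **Knockoffs under $\mathbb Q$.** For each student, given the observed data $(\mathcal A_i,\mathbf Z_i^{\rm obs},\mathbf Y_i)$, sample underlying variables $\mathbf U_i$ from the conditional distribution under $\mathbb Q$ of the underlying variables given $\mathbf Z^{\rm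 obs}_i$ and $\mathbf Y_i$; then sample $\tilde{\mathbf U}_i$ from the conditional distribution of the second block given that the first block equals $\mathbf U_i$ in the centred normal distribution with covariance $\begin{pmatrix}\hat{\boldsymbol\Sigma}&\hat{\boldsymbol\Sigma}-\mathbf S\\ \hat{\boldsymbol\Sigma}-\mathbf S&\hat{\boldsymbol\Sigma}\end{pmatrix}$, where $\mathbf S$ is a diagonal matrix for which this covariance is positive definite; put $\tilde Z_{ij}=\hat F_j(\tilde U_{ij})$ and $\tilde{\mathbf Z}^{\rm obs}_i=(\tilde Z_{ij})_{j\in\mathcal A_i}$, $\tilde{\mathbf Z}^{\rm obs}_{i,-j}=(\tilde Z_{ik})_{k\in\mathcal A_i\setminus\{j\}}$. **Selection.** Let $W_j$, $j=1,\dots,p$, be (measurable) knockoff statistics computed from the observed data and the knockoffs: for every set $\mathcal S$ of predictors, swapping the entries $Z_{ij}$ and $\tilde Z_{ij}$ for all $i$ and all $j\in\mathcal S\cap\mathcal A_i$ changes the sign of $W_j$ for $j\in\mathcal S$ and leaves $W_j$ unchanged for $j\notin\mathcal S$. For an integer $\nu\ge1$ let $\tau=\inf\{t>0:1+|\{j:W_j<-t\}|\le\nu\}$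 and $\hat{\mathcal S}=\{j:W_j>\tau\}$. **Observed KL divergence.** For $j\notin\mathcal S^*$ let $$\widehat{\mathrm{KL}}_j=\sum_{i:\,j\in\mathcal A_i}\log\frac{\mathbb P_{ij}(Z_{ij}\mid\mathbf Z^{\rm obs}_{i,-j},\mathbf Y_i)\,\mathbb Q_{ij}(\tilde{\mathbf Z}^{\rm obs}_{i,-j},\tilde Z_{ij}\mid\mathbf Z^{\rm obs}_{i,-j},Z_{ij},\mathbf Y_i)}{\mathbb P_{ij}(\tilde Z_{ij}\mid\mathbf Z^{\rm obs}_{i,-j},\mathbf Y_i)\,\mathbb Q_{ij}(\tilde{\mathbf Z}^{\rm obs}_{i,-j},Z_{ij}\mid\mathbf Z^{\rm obs}_{i,-j},\tilde Z_{ij},\mathbf Y_i)},$$ where $\mathbb P_{ij}(\cdot\mid\cdot)$ is the conditional density of $Z_{ij}$ under $\mathbb P$ and $\mathbb Q_{ij}(\cdot\mid\cdot)$ that of the observed knockoffs under $\mathbb Q$, for the given set $\mathcal A_i$ of observed predictors. **Theorem.** For every $\epsilon\ge0$, $$\mathbb E\,\bigl|\{j:\ j\in\hat{\mathcal S}\setminus\mathcal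 S^*\text{ and }\widehat{\mathrm{KL}}_j\le\epsilon\}\bigr|\le\nu e^{\epsilon}.$$ If $\mathbb Q=\mathbb P$, then $\widehat{\mathrm{KL}}_j=0$ for every null predictor $j\notin\mathcal S^*$. -/

import Mathlib

open MeasureTheory ProbabilityTheory
open scoped ENNReal NNReal

noncomputable section

namespace KnockoffIRT

/-! ### Predictors -/

/-- The type of a predictor.  A categorical predictor takes the values `0, …, K`;
it is binary if `K = 1` and ordinal if `K > 1`. -/
inductive PredictorKind where
  | continuous : PredictorKind
  | categorical (K : ℕ) : PredictorKind

/-- The dimension of the slope parameter of a predictor: `1` for a continuous one, the number `K`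
of dummy variables for a categorical one with values `0, …, K`. -/
def PredictorKind.dim : PredictorKind → ℕ
  | .continuous => 1
  | .categorical K => K

/-- The regressors `g(z)` of a predictor: `z` itself if it is continuous, and the dummies
`(𝟙{z ≥ 1}, …, 𝟙{z ≥ K})` if it is categorical (for a binary predictor this is again `z`). -/
def PredictorKind.regressor : (κ : PredictorKind) → ℝ → Fin κ.dim → ℝ
  | .continuous, z, _ => z
  | .categorical _, z, k => if ((k : ℕ) : ℝ) + 1 ≤ z then 1 else 0

/-- The marginal transformation of a predictor in the copula model: an increasing affine map, or
strictly increasing cut points `c₁ < ⋯ < c_K`. -/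
inductive Transform : PredictorKind → Type
  | affine (c d : ℝ) (hd : 0 < d) : Transform .continuous
  | cuts {K : ℕ} (c : Fin K → ℝ) (hc : StrictMono c) : Transform (.categorical K)

/-- The predictor as a function of its underlying variable: `c + d x`, respectively the `k` with
`c_k < x ≤ c_{k+1}` (where `c₀ = -∞`, `c_{K+1} = ∞`), which is the number of cut points below
`x`. -/
def Transform.toFun : {κ : PredictorKind} → Transform κ → ℝ → ℝ
  | _, .affine c d _, x => c + d * x
  | _, .cuts c _, x => ((Finset.univ.filter fun k => c k < x).card : ℝ)

/-- The fibre of the transformation over the value `z`, as a measure on the underlying real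
variable: integrating against it turns a density of the underlying variable into a density of the
predictor (with respect to Lebesgue measure, respectively counting measure). -/
def Transform.fibre : {κ : PredictorKind} → Transform κ → ℝ → Measure ℝ
  | _, .affine c d _, z => ENNReal.ofReal d⁻¹ • Measure.dirac ((z - c) / d)
  | _, .cuts c hc, z => volume.restrict {x | (Transform.cuts c hc).toFun x = z}

/-! ### Multivariate normal densities -/

/-- The density of the (nondegenerate) multivariate normal distribution `N(0, V)`. -/
def normalDensity {n : Type*} [Fintype n] [DecidableEq n] (V : Matrix n n ℝ) (x : n → ℝ) : ℝ≥0∞ :=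
  ENNReal.ofReal ((Real.sqrt ((2 * Real.pi) ^ Fintype.card n * V.det))⁻¹ *
    Real.exp (-(x ⬝ᵥ V⁻¹.mulVec x) / 2))

/-- The joint covariance matrix `[[V, V - S], [V - S, V]]`, `S = diag s`, of the underlying
variables and their knockoffs. -/
def jointCov {p : ℕ} (V : Matrix (Fin p) (Fin p) ℝ) (s : Fin p → ℝ) :
    Matrix (Fin p ⊕ Fin p) (Fin p ⊕ Fin p) ℝ :=
  Matrix.fromBlocks V (V - Matrix.diagonal s) (V - Matrix.diagonal s) V

/-! ### Measurement model -/

/-- Item-specific parameters.  Item `l` has the categories `0, …, K l`. -/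
structure Items (ι : Type*) where
  /-- the largest category -/
  K : ι → ℕ
  /-- the discriminations -/
  a : ι → ℝ
  /-- the intercepts `b_{l1}, …, b_{l K_l}` (other indices are irrelevant) -/
  b : ι → ℕ → ℝ

/-- The generalised partial credit model: the probability of response `k` to item `l` at ability
`t`.  If `K l = 1` this is the two-parameter logistic model. -/
def Items.prob {ι : Type*} (I : Items ι) (l : ι) (t : ℝ) (k : ℕ) : ℝ :=
  Real.exp (∑ r ∈ Finset.Icc 1 k, (I.a l * t + I.b l r)) /
    ∑ m ∈ Finset.range (I.K l + 1), Real.exp (∑ r ∈ Finset.Icc 1 m, (I.a l * t + I.b l r))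

/-- The possible responses of a student to the set `B` of assigned items. -/
abbrev Items.Resp {ι : Type*} (I : Items ι) (B : Finset ι) : Type _ :=
  (l : {l // l ∈ B}) → Fin (I.K l + 1)

/-- The probability of the response vector `y` at ability `t` (local independence). -/
def Items.respProb {ι : Type*} (I : Items ι) {B : Finset ι} (t : ℝ) (y : I.Resp B) : ℝ≥0∞ :=
  ∏ l : {l // l ∈ B}, ENNReal.ofReal (I.prob l t (y l))

/-! ### Parameters of the latent regression model with Gaussian copula predictors -/

/-- The parameters of the Gaussian copula model (nondegenerate correlation matrix and
transformations) and of the structural model (intercept, slopes, residual variance). -/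
structure Params {p : ℕ} (kind : Fin p → PredictorKind) where
  /-- the correlation matrix of the underlying variables -/
  corr : Matrix (Fin p) (Fin p) ℝ
  corr_posDef : corr.PosDef
  corr_diag : ∀ j, corr j j = 1
  /-- the marginal transformations -/
  transf : (j : Fin p) → Transform (kind j)
  /-- the intercept -/
  intercept : ℝ
  /-- the slopes -/
  slope : (j : Fin p) → Fin (kind j).dim → ℝ
  /-- the residual variance -/
  resVar : ℝ≥0
  resVar_pos : 0 < resVar

section Model

variable {p : ℕ} {kind : Fin p → PredictorKind} {ι : Type*}

/-- The non-null predictors: those with a nonzero slope vector. -/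
def Params.nonNull (M : Params kind) : Set (Fin p) := {j | M.slope j ≠ 0}

/-- The complete predictors as a function of the underlying variables. -/
def Params.predictors (M : Params kind) (x : Fin p → ℝ) : Fin p → ℝ :=
  fun j => (M.transf j).toFun (x j)

/-- The conditional mean of the ability given the complete predictors. -/
def Params.abilityMean (M : Params kind) (z : Fin p → ℝ) : ℝ :=
  M.intercept + ∑ j, ∑ k, M.slope j k * (kind j).regressor (z j) k

/-- The conditional probability of the responses `y` given the complete predictors `z`. -/
def Params.respDensity (M : Params kind) (I : Items ι) {B : Finset ι} (y : I.Resp B)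
    (z : Fin p → ℝ) : ℝ≥0∞ :=
  ∫⁻ t, I.respProb t y ∂(gaussianReal (M.abilityMean z) M.resVar)

/-- The measure on the underlying variables that integrates them over the fibre of `z j` for each
observed predictor `j ∈ α`, and over the whole line for each missing one. -/
def Params.fibre (M : Params kind) (α : Finset (Fin p)) (z : Fin p → ℝ) : Measure (Fin p → ℝ) :=
  Measure.pi fun j => if j ∈ α then (M.transf j).fibre (z j) else volume

/-- The joint density of `(Z_j)_{j ∈ α}` and `Y` at `((z j)_{j ∈ α}, y)`. -/
def Params.obsDensity (M : Params kind) (I : Items ι) {B : Finset ι} (α : Finset (Fin p))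
    (z : Fin p → ℝ) (y : I.Resp B) : ℝ≥0∞ :=
  ∫⁻ x, normalDensity M.corr x * M.respDensity I y (M.predictors x) ∂(M.fibre α z)

/-- The joint density of `(Z_j)_{j ∈ α}`, the knockoffs `(Z̃_j)_{j ∈ α}` and `Y`, under the model
in which the underlying variables have covariance `jointCov corr s` and `Z̃` is conditionally
independent of `Y` given `Z`. -/
def Params.jointDensity (M : Params kind) (s : Fin p → ℝ) (I : Items ι) {B : Finset ι}
    (α : Finset (Fin p)) (z zt : Fin p → ℝ) (y : I.Resp B) : ℝ≥0∞ :=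
  ∫⁻ x, ∫⁻ xt, normalDensity (jointCov M.corr s) (Sum.elim x xt) *
    M.respDensity I y (M.predictors x) ∂(M.fibre α zt) ∂(M.fibre α z)

/-- The conditional density of `Z_j` at `z j` given `(Z_k)_{k ∈ α \ {j}}` and `Y`. -/
def Params.condDensity (M : Params kind) (I : Items ι) {B : Finset ι} (α : Finset (Fin p))
    (j : Fin p) (z : Fin p → ℝ) (y : I.Resp B) : ℝ≥0∞ :=
  M.obsDensity I α z y / M.obsDensity I (α.erase j) z y

/-- The conditional density of the knockoffs `(Z̃_k)_{k ∈ α}` at `zt` given `(Z_k)_{k ∈ α}`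
and `Y`. -/
def Params.knockoffDensity (M : Params kind) (s : Fin p → ℝ) (I : Items ι) {B : Finset ι}
    (α : Finset (Fin p)) (z zt : Fin p → ℝ) (y : I.Resp B) : ℝ≥0∞ :=
  M.jointDensity s I α z zt y / M.obsDensity I α z y

/-- The observed Kullback-Leibler divergence of predictor `j`, for the true model `P`, the plug-in
model `Q` (knockoffs constructed with the diagonal matrix `diag s`), and data of `N` students with
assigned items `B i`, observed predictors `A i`, predictors `z i`, knockoffs `zt i` and responses
`y i`. -/
def klHat (P Q : Params kind) (s : Fin p → ℝ) (I : Items ι) {N : ℕ} (B : Fin N → Finset ι)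
    (A : Fin N → Finset (Fin p)) (z zt : Fin N → Fin p → ℝ) (y : (i : Fin N) → I.Resp (B i))
    (j : Fin p) : ℝ :=
  ∑ i ∈ Finset.univ.filter (fun i => j ∈ A i), Real.log
    ((P.condDensity I (A i) j (z i) (y i) *
        Q.knockoffDensity s I (A i) (z i) (zt i) (y i)) /
      (P.condDensity I (A i) j (Function.update (z i) j (zt i j)) (y i) *
        Q.knockoffDensity s I (A i) (Function.update (z i) j (zt i j))
          (Function.update (zt i) j (z i j)) (y i))).toReal

/-! ### Generation of the knockoffs -/

/-- The conditional distribution of the underlying variables given `(Z_j)_{j ∈ α} = (z j)_{j ∈ α}`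
and `Y = y`. -/
def Params.latentPosterior (M : Params kind) (I : Items ι) {B : Finset ι} (α : Finset (Fin p))
    (z : Fin p → ℝ) (y : I.Resp B) : Measure (Fin p → ℝ) :=
  (M.obsDensity I α z y)⁻¹ • (M.fibre α z).withDensity
    (fun x => normalDensity M.corr x * M.respDensity I y (M.predictors x))

/-- The conditional distribution of `xt` given `x`, if `(x, xt)` is normal with mean zero and
covariance `jointCov corr s`. -/
def Params.knockoffKernel (M : Params kind) (s x : Fin p → ℝ) : Measure (Fin p → ℝ) :=
  volume.withDensity
    (fun xt => normalDensity (jointCov M.corr s) (Sum.elim x xt) / normalDensity M.corr x)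

/-- The observed part of `z`: the entries outside `α` are replaced by `0`. -/
def mask (α : Finset (Fin p)) (z : Fin p → ℝ) : Fin p → ℝ := fun j => if j ∈ α then z j else 0

end Model

/-- `κ` is (a version of) the conditional distribution of `X` given `D`. -/
def HasCondLaw {Ω E F : Type*} [MeasurableSpace Ω] [MeasurableSpace E] [StandardBorelSpace E]
    [Nonempty E] [MeasurableSpace F] (X : Ω → E) (D : Ω → F) (κ : F → Measure E)
    (μ : Measure Ω) [IsFiniteMeasure μ] : Prop :=
  ∀ᵐ d ∂(μ.map D), condDistrib X D μ d = κ d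

/-- The stronger missing-at-random condition with respect to the set `S` of predictors, for the
conditional probability mass function `q · z` of the set of observed predictors given `Z = z`. -/
def SMAR {p : ℕ} (S : Set (Fin p)) (q : (Fin p → ℝ) → PMF (Finset (Fin p))) : Prop :=
  ∀ (α : Finset (Fin p)) (z z' : Fin p → ℝ),
    (∀ k ∈ α, k ∈ S → z k = z' k) → q z α = q z' α

/-- The data of `N` independent students under the true model `P`, and the knockoffs that are
generated from them under the plug-in model `Q`.  For student `i`, `X i` are the underlying
variables, `Θ i` is the ability, `Y i` are the responses to the assigned items `B i`, and `A i` is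
the set of observed predictors; `Xs i` and `Xt i` are the underlying variables and their knockoffs
that are sampled in the construction of the knockoffs. -/
structure IsPlugInKnockoffData {Ω : Type*} [MeasurableSpace Ω] (μ : Measure Ω)
    [IsProbabilityMeasure μ] {p N : ℕ} {kind : Fin p → PredictorKind} {ι : Type*}
    (I : Items ι) (B : Fin N → Finset ι) (P Q : Params kind) (s : Fin p → ℝ)
    (q : Fin N → (Fin p → ℝ) → PMF (Finset (Fin p)))
    (X : Fin N → Ω → Fin p → ℝ) (Θ : Fin N → Ω → ℝ) (Y : (i : Fin N) → Ω → I.Resp (B i))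
    (A : Fin N → Ω → Finset (Fin p)) (Xs Xt : Fin N → Ω → Fin p → ℝ) : Prop where
  measurable_X : ∀ i, Measurable (X i)
  measurable_Θ : ∀ i, Measurable (Θ i)
  measurable_Y : ∀ i, Measurable (Y i)
  measurable_A : ∀ i, Measurable (A i)
  measurable_Xs : ∀ i, Measurable (Xs i)
  measurable_Xt : ∀ i, Measurable (Xt i)
  /-- different students are independent -/
  indep : iIndepFun (fun i ω => (X i ω, Θ i ω, Y i ω, A i ω, Xs i ω, Xt i ω)) μ
  /-- Gaussian copula model -/
  law_X : ∀ i, μ.map (X i) = volume.withDensity (normalDensity P.corr)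
  /-- structural model, given the complete predictors -/
  law_Θ : ∀ i, HasCondLaw (Θ i) (fun ω => P.predictors (X i ω))
    (fun z => gaussianReal (P.abilityMean z) P.resVar) μ
  /-- measurement model, given the ability (and the complete predictors) -/
  law_Y : ∀ i, HasCondLaw (Y i) (fun ω => (P.predictors (X i ω), Θ i ω))
    (fun d => Measure.count.withDensity (fun y => I.respProb d.2 y)) μ
  /-- missingness: `q i` is the conditional probability mass function of `A i` given the complete
  predictors, and `A i` is conditionally independent of `Y i` given the complete predictors -/
  law_A : ∀ i, HasCondLaw (A i) (fun ω => (P.predictors (X i ω), Y i ω))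
    (fun d => (q i d.1).toMeasure) μ
  /-- underlying variables are sampled under `Q` given the observed data -/
  law_Xs : ∀ i, HasCondLaw (Xs i) (fun ω => (A i ω, mask (A i ω) (P.predictors (X i ω)), Y i ω))
    (fun d => Q.latentPosterior I d.1 d.2.1 d.2.2) μ
  /-- knockoffs of the underlying variables are sampled under `Q` -/
  law_Xt : ∀ i, HasCondLaw (Xt i)
    (fun ω => ((A i ω, mask (A i ω) (P.predictors (X i ω)), Y i ω), Xs i ω))
    (fun d => Q.knockoffKernel s d.2) μ

/-! ### Knockoff statistics and selection -/

/-- `z` with the columns `j ∈ S` replaced by those of `zt`. -/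
def swapCols {p N : ℕ} (S : Set (Fin p)) [DecidablePred (· ∈ S)] (z zt : Fin N → Fin p → ℝ) :
    Fin N → Fin p → ℝ :=
  fun i j => if j ∈ S then zt i j else z i j

/-- The statistic `w j`, a function of the missingness pattern `A`, the observed predictors, the
observed knockoffs and the responses, has the flip-sign property for every `j`. -/
def IsKnockoffStatistic {p N : ℕ} {R : Type*}
    (w : Fin p → (Fin N → Finset (Fin p)) → (Fin N → Fin p → ℝ) → (Fin N → Fin p → ℝ) → R → ℝ) :
    Prop :=
  ∀ (j : Fin p) (S : Finset (Fin p)) (A : Fin N → Finset (Fin p)) (z zt : Fin N → Fin p → ℝ)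
    (y : R),
    w j A (fun i => mask (A i) (swapCols S z zt i)) (fun i => mask (A i) (swapCols S zt z i)) y =
      if j ∈ S then -w j A (fun i => mask (A i) (z i)) (fun i => mask (A i) (zt i)) y
      else w j A (fun i => mask (A i) (z i)) (fun i => mask (A i) (zt i)) y

/-- The threshold `τ = inf {t > 0 : 1 + |{j : W j < -t}| ≤ ν}`. -/
def threshold {p : ℕ} (ν : ℕ) (W : Fin p → ℝ) : ℝ :=
  sInf {t : ℝ | 0 < t ∧ 1 + (Finset.univ.filter fun j => W j < -t).card ≤ ν}

/-- The selected predictors `{j : W j > τ}`. -/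
def selected {p : ℕ} (ν : ℕ) (W : Fin p → ℝ) : Set (Fin p) := {j | threshold ν W < W j}

/-- If the count `1 + |{j : W j < -t}|` attains the value `ν`, the threshold is the infimum of the
`t > 0` at which it does. -/
theorem threshold_eq_sInf_eq {p : ℕ} (ν : ℕ) (W : Fin p → ℝ)
    (h : {t : ℝ | 0 < t ∧ 1 + (Finset.univ.filter fun j => W j < -t).card = ν}.Nonempty) :
    threshold ν W =
      sInf {t : ℝ | 0 < t ∧ 1 + (Finset.univ.filter fun j => W j < -t).card = ν} := by
  obtain ⟨t₀, ht₀, hc₀⟩ := h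
  have bdd (S : ℕ → Prop) :
      BddBelow {t : ℝ | 0 < t ∧ S (1 + (Finset.univ.filter fun j => W j < -t).card)} :=
    ⟨0, fun t ht => le_of_lt ht.1⟩
  unfold threshold
  apply le_antisymm
  · exact csInf_le_csInf (bdd fun n => n ≤ ν) ⟨t₀, ht₀, hc₀⟩ fun t ht => ⟨ht.1, ht.2.le⟩
  · refine le_csInf ⟨t₀, ht₀, hc₀.le⟩ fun t ht => ?_
    by_cases hle : t₀ ≤ t
    · exact (csInf_le (bdd fun n => n = ν) ⟨ht₀, hc₀⟩).trans hle
    · refine csInf_le (bdd fun n => n = ν) ⟨ht.1, le_antisymm ht.2 ?_⟩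
      rw [← hc₀]
      refine Nat.add_le_add_left (Finset.card_le_card fun j hj => ?_) 1
      simp only [Finset.mem_filter, Finset.mem_univ, true_and] at hj ⊢
      linarith [not_le.mp hle]

end KnockoffIRT

end

/-!
The likelihood ratio of the data and the data with the `Z_ij` exchanged with their knockoffs is
`exp KL_j` for a null `j`: the missingness does not depend on `Z_ij`, so its probability cancels,
as does the density of the remaining observed predictors and the responses.  The exchange also
changes the sign of `W_j` and of no other statistic.  It therefore carries the event that `j` is
selected, weighted by `exp (-KL_j)`, into the event that `W_j < 0` while `|W_j|` exceeds the
threshold of the statistics with `W_j` replaced by `|W_j|`.  Whatever the data, at most `ν`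
predictors `j` satisfy the latter, by the definition of `τ`.  Hence the expectation of the sum of
`exp (-KL_j)` over the selected null `j` is at most `ν`, and a selected null `j` with `KL_j ≤ ε`
contributes at least `exp (-ε)` to this sum.

If `ℚ = ℙ`, the joint density of predictors, knockoffs and responses is itself invariant under the
exchange, because the responses do not depend on `Z_ij` either; so the likelihood ratio is `1`.
-/

noncomputable section

namespace KnockoffIRT

/-! ### Product measures -/

section Pi

variable {n : Type*} {E : n → Type*} [∀ i, MeasurableSpace (E i)]
  (μ : ∀ i, Measure (E i)) [∀ i, SigmaFinite (μ i)] {f : ∀ i, E i → ℝ≥0∞}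

theorem lmarginal_prod [DecidableEq n] (hf : ∀ i, Measurable (f i)) (s : Finset n)
    (x : ∀ i, E i) :
    (∫⋯∫⁻_s, (fun x => ∏ i ∈ s, f i (x i)) ∂μ) x = ∏ i ∈ s, ∫⁻ t, f i t ∂(μ i) := by
  have hm (s : Finset n) : Measurable fun x : ∀ i, E i => ∏ i ∈ s, f i (x i) := by fun_prop
  induction s using Finset.induction_on with
  | empty => simp
  | insert i s his ih =>
    have factor : (fun x => ∫⁻ t, ∏ k ∈ insert i s, f k (Function.update x i t k) ∂(μ i)) =
        fun x => (∫⁻ t, f i t ∂(μ i)) * ∏ k ∈ s, f k (x k) := by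
      funext x
      rw [← lintegral_mul_const _ (hf i)]
      refine lintegral_congr fun t => ?_
      rw [Finset.prod_insert his, Function.update_self]
      congr 1
      refine Finset.prod_congr rfl fun k hk => ?_
      rw [Function.update_of_ne (ne_of_mem_of_not_mem hk his)]
    rw [lmarginal_insert' _ (hm _) his, factor, Finset.prod_insert his, ← ih]
    simp only [lmarginal]
    exact lintegral_const_mul _ ((hm s).comp measurable_updateFinset)

variable [Fintype n]

variable {μ} in
theorem ae_pi_forall {P : ∀ i, E i → Prop} (h : ∀ i, ∀ᵐ x ∂(μ i), P i x) :
    ∀ᵐ x ∂(Measure.pi μ), ∀ i, P i (x i) :=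
  ae_all_iff.mpr fun i => Measure.tendsto_eval_ae_ae.eventually (h i)

theorem lintegral_pi_prod (hf : ∀ i, Measurable (f i)) :
    ∫⁻ x, ∏ i, f i (x i) ∂(Measure.pi μ) = ∏ i, ∫⁻ t, f i t ∂(μ i) := by
  classical
  rcases isEmpty_or_nonempty (∀ i, E i) with h | ⟨⟨x₀⟩⟩
  · obtain ⟨i, hi⟩ := isEmpty_pi.mp h
    rw [lintegral_of_isEmpty]
    exact (Finset.prod_eq_zero (Finset.mem_univ i) (lintegral_of_isEmpty _ _)).symm
  · rw [lintegral_eq_lmarginal_univ x₀, lmarginal_prod μ hf]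

theorem pi_withDensity (hf : ∀ i, Measurable (f i))
    [∀ i, SigmaFinite ((μ i).withDensity (f i))] :
    Measure.pi (fun i => (μ i).withDensity (f i)) =
      (Measure.pi μ).withDensity fun x => ∏ i, f i (x i) := by
  refine Measure.pi_eq fun s hs => ?_
  rw [withDensity_apply _ (MeasurableSet.univ_pi hs), Measure.restrict_pi_pi,
    lintegral_pi_prod _ hf]
  exact Finset.prod_congr rfl fun i _ => (withDensity_apply _ (hs i)).symm

theorem bind_pi {T : n → Type*} [∀ i, MeasurableSpace (T i)] (l : ∀ i, Measure (T i))
    [∀ i, SigmaFinite (l i)] {κ : ∀ i, T i → Measure (E i)} [∀ i t, SigmaFinite (κ i t)]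
    [∀ i, SigmaFinite ((l i).bind (κ i))] (hκ : ∀ i, Measurable (κ i))
    (hpi : Measurable fun t : ∀ i, T i => Measure.pi fun i => κ i (t i)) :
    (Measure.pi l).bind (fun t => Measure.pi fun i => κ i (t i)) =
      Measure.pi fun i => (l i).bind (κ i) := by
  refine (Measure.pi_eq fun s hs => ?_).symm
  rw [Measure.bind_apply (MeasurableSet.univ_pi hs) hpi.aemeasurable]
  simp_rw [Measure.pi_pi, Measure.bind_apply (hs _) (hκ _).aemeasurable]
  exact lintegral_pi_prod l fun i => (Measure.measurable_coe (hs i)).comp (hκ i)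

end Pi

/-! ### Exchange of a coordinate -/

section SwapPair

variable {n : Type*} [DecidableEq n] {E : Type*} (j : n)

/-- The exchange of coordinate `j` between two vectors, such as the predictors and their
knockoffs. -/
def swapPair (x : (n → E) × (n → E)) : (n → E) × (n → E) :=
  (Function.update x.1 j (x.2 j), Function.update x.2 j (x.1 j))

theorem sumElim_swapPair (x : (n → E) × (n → E)) :
    Sum.elim (swapPair j x).1 (swapPair j x).2 =
      Sum.elim x.1 x.2 ∘ Equiv.swap (Sum.inl j) (Sum.inr j) := by
  ext (k | k) <;> rcases eq_or_ne k j with rfl | h <;>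
    simp [swapPair, Equiv.swap_apply_of_ne_of_ne, *]

variable [MeasurableSpace E]

@[fun_prop]
theorem measurable_sumElim {m n : Type*} :
    Measurable fun x : (m → E) × (n → E) => Sum.elim x.1 x.2 :=
  measurable_pi_lambda _ fun k => by cases k <;> simp only [Sum.elim_inl, Sum.elim_inr] <;> fun_prop

@[fun_prop]
theorem measurable_swapPair : Measurable (swapPair j : (n → E) × (n → E) → (n → E) × (n → E)) := by
  unfold swapPair
  refine .prodMk (measurable_pi_lambda _ fun k => ?_) (measurable_pi_lambda _ fun k => ?_) <;>
    rcases eq_or_ne k j with rfl | h <;> simp only [Function.update_apply, *, if_true, if_false] <;>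
    fun_prop

instance sigmaFinite_update (μ : n → Measure E) [∀ i, SigmaFinite (μ i)] (m : Measure E)
    [SigmaFinite m] (i : n) : SigmaFinite (Function.update μ j m i) := by
  rcases eq_or_ne i j with rfl | h
  · rwa [Function.update_self]
  · rw [Function.update_of_ne h]
    infer_instance

theorem measurePreserving_swapPair [Fintype n] (μ ν : n → Measure E) [∀ i, SigmaFinite (μ i)]
    [∀ i, SigmaFinite (ν i)] :
    MeasurePreserving (swapPair j) ((Measure.pi μ).prod (Measure.pi ν))
      ((Measure.pi (Function.update μ j (ν j))).prod
        (Measure.pi (Function.update ν j (μ j)))) := by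
  let σ (i : n) : E × E → E × E := if i = j then Prod.swap else id
  have hσ (i : n) : MeasurePreserving (σ i) ((μ i).prod (ν i))
      ((Function.update μ j (ν j) i).prod (Function.update ν j (μ j) i)) := by
    rcases eq_or_ne i j with rfl | h
    · simpa [σ] using Measure.measurePreserving_swap
    · simpa [σ, h] using MeasurePreserving.id _
  have h := (measurePreserving_arrowProdEquivProdArrow E E n _ _).comp
    ((measurePreserving_pi _ _ hσ).comp
      (measurePreserving_arrowProdEquivProdArrow E E n μ ν).symm)
  convert h using 1
  funext x
  ext i <;> rcases eq_or_ne i j with rfl | hi <;>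
    simp [swapPair, σ, *, MeasurableEquiv.arrowProdEquivProdArrow, Equiv.arrowProdEquivProdArrow]

end SwapPair

/-! ### Conditional distributions -/

theorem HasCondLaw.lintegral_eq {Ω E F : Type*} [MeasurableSpace Ω] [MeasurableSpace E]
    [StandardBorelSpace E] [Nonempty E] [MeasurableSpace F] {X : Ω → E} {D : Ω → F}
    {κ : F → Measure E} {μ : Measure Ω} [IsFiniteMeasure μ] (h : HasCondLaw X D κ μ)
    (hX : Measurable X) (hD : Measurable D) {g : F × E → ℝ≥0∞} (hg : Measurable g) :
    ∫⁻ ω, g (D ω, X ω) ∂μ = ∫⁻ ω, ∫⁻ x, g (D ω, x) ∂(κ (D ω)) ∂μ :=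
  calc ∫⁻ ω, g (D ω, X ω) ∂μ
      = ∫⁻ a, g a ∂(μ.map fun ω => (D ω, X ω)) := (lintegral_map hg (hD.prodMk hX)).symm
    _ = ∫⁻ d, ∫⁻ x, g (d, x) ∂(condDistrib X D μ d) ∂(μ.map D) := by
        rw [← compProd_map_condDistrib hX.aemeasurable, Measure.lintegral_compProd hg]
    _ = ∫⁻ ω, ∫⁻ x, g (D ω, x) ∂(condDistrib X D μ (D ω)) ∂μ :=
        lintegral_map (hg.lintegral_kernel_prod_right') hD
    _ = ∫⁻ ω, ∫⁻ x, g (D ω, x) ∂(κ (D ω)) ∂μ := by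
        refine lintegral_congr_ae ?_
        filter_upwards [ae_of_ae_map hD.aemeasurable h] with ω hω
        rw [hω]

/-! ### Normal densities -/

section Normal

variable {n : Type*} [Fintype n]

theorem exists_mul_norm_sq_le_of_posDef {V : Matrix n n ℝ} (hV : V.PosDef) :
    ∃ c : ℝ, 0 < c ∧ ∀ x : n → ℝ, c * ‖x‖ ^ 2 ≤ x ⬝ᵥ V.mulVec x := by
  rcases isEmpty_or_nonempty n with hn | hn
  · exact ⟨1, one_pos, fun x => by simp [Subsingleton.elim x 0]⟩
  have hcont : Continuous fun x : n → ℝ => x ⬝ᵥ V.mulVec x := by fun_prop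
  obtain ⟨x₀, hx₀, hmin⟩ := (isCompact_sphere (0 : n → ℝ) 1).exists_isMinOn
    (NormedSpace.sphere_nonempty.mpr zero_le_one) hcont.continuousOn
  have hx₀_ne : x₀ ≠ 0 := ne_zero_of_mem_unit_sphere ⟨x₀, hx₀⟩
  refine ⟨x₀ ⬝ᵥ V.mulVec x₀, by simpa using hV.dotProduct_mulVec_pos hx₀_ne, fun x => ?_⟩
  rcases eq_or_ne x 0 with rfl | hx
  · simp
  have hx_pos : 0 < ‖x‖ := norm_pos_iff.mpr hx
  have hunit := hmin (a := ‖x‖⁻¹ • x) (by simp [norm_smul, hx_pos.ne'])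
  simp only [Set.mem_ofPred_eq, Matrix.mulVec_smul, dotProduct_smul, smul_dotProduct,
    smul_eq_mul] at hunit
  calc x₀ ⬝ᵥ V.mulVec x₀ * ‖x‖ ^ 2
      ≤ (‖x‖⁻¹ * (‖x‖⁻¹ * (x ⬝ᵥ V.mulVec x))) * ‖x‖ ^ 2 := by gcongr
    _ = x ⬝ᵥ V.mulVec x := by field_simp

theorem exists_mul_sum_sq_le_of_posDef {V : Matrix n n ℝ} (hV : V.PosDef) :
    ∃ c : ℝ, 0 < c ∧ ∀ x : n → ℝ, c * ∑ i, x i ^ 2 ≤ x ⬝ᵥ V.mulVec x := by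
  rcases isEmpty_or_nonempty n with hn | hn
  · exact ⟨1, one_pos, fun x => by simp [dotProduct]⟩
  obtain ⟨c, hc, h⟩ := exists_mul_norm_sq_le_of_posDef hV
  refine ⟨c / Fintype.card n, by positivity, fun x => ?_⟩
  have sum_le : ∑ i, x i ^ 2 ≤ Fintype.card n * ‖x‖ ^ 2 :=
    calc ∑ i, x i ^ 2 ≤ ∑ _i : n, ‖x‖ ^ 2 :=
          Finset.sum_le_sum fun i _ => sq_le_sq.mpr ((norm_le_pi_norm x i).trans (le_abs_self _))
      _ = Fintype.card n * ‖x‖ ^ 2 := by simp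
  calc c / Fintype.card n * ∑ i, x i ^ 2
      ≤ c / Fintype.card n * (Fintype.card n * ‖x‖ ^ 2) := by gcongr
    _ = c * ‖x‖ ^ 2 := by field_simp
    _ ≤ x ⬝ᵥ V.mulVec x := h x

variable [DecidableEq n]

@[fun_prop]
theorem measurable_normalDensity (V : Matrix n n ℝ) : Measurable (normalDensity V) := by
  unfold normalDensity
  fun_prop

theorem normalDensity_ne_zero {V : Matrix n n ℝ} (hV : V.PosDef) (x : n → ℝ) :
    normalDensity V x ≠ 0 := by
  have hdet := hV.det_pos
  rw [normalDensity, Ne, ENNReal.ofReal_eq_zero, not_le]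
  positivity

theorem normalDensity_ne_top (V : Matrix n n ℝ) (x : n → ℝ) : normalDensity V x ≠ ∞ :=
  ENNReal.ofReal_ne_top

theorem exists_normalDensity_le {V : Matrix n n ℝ} (hV : V.PosDef) :
    ∃ (C : ℝ≥0∞) (c : ℝ), C ≠ ∞ ∧ 0 < c ∧
      ∀ x, normalDensity V x ≤ C * ∏ i, ENNReal.ofReal (Real.exp (-c * x i ^ 2)) := by
  obtain ⟨c, hc, h⟩ := exists_mul_sum_sq_le_of_posDef hV.inv
  refine ⟨ENNReal.ofReal (Real.sqrt ((2 * Real.pi) ^ Fintype.card n * V.det))⁻¹, c / 2,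
    ENNReal.ofReal_ne_top, by positivity, fun x => ?_⟩
  rw [normalDensity, ENNReal.ofReal_mul (by positivity)]
  gcongr
  rw [← ENNReal.ofReal_prod_of_nonneg fun i _ => (Real.exp_pos _).le, ← Real.exp_sum,
    ← Finset.mul_sum]
  gcongr
  linarith [h x]

theorem normalDensity_comp_equiv {V : Matrix n n ℝ} (e : n ≃ n) (hV : V.submatrix e e = V)
    (x : n → ℝ) : normalDensity V (x ∘ e) = normalDensity V x := by
  have quadForm_comp : (x ∘ e) ⬝ᵥ V⁻¹.mulVec (x ∘ e) = x ⬝ᵥ V⁻¹.mulVec x := by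
    nth_rw 1 [← hV]
    rw [Matrix.inv_submatrix_equiv, Matrix.submatrix_mulVec_equiv, Function.comp_assoc,
      Equiv.self_comp_symm, Function.comp_id, comp_equiv_dotProduct_comp_equiv]
  rw [normalDensity, normalDensity, quadForm_comp]

end Normal

theorem jointCov_submatrix_swap {p : ℕ} {V : Matrix (Fin p) (Fin p) ℝ} (s : Fin p → ℝ)
    (j : Fin p) :
    (jointCov V s).submatrix (Equiv.swap (Sum.inl j) (Sum.inr j))
      (Equiv.swap (Sum.inl j) (Sum.inr j)) = jointCov V s := by
  ext (a | a) (b | b) <;> by_cases ha : a = j <;> by_cases hb : b = j <;>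
    simp_all [jointCov, Matrix.diagonal, Equiv.swap_apply_def, eq_comm]

theorem normalDensity_jointCov_swapPair {p : ℕ} (V : Matrix (Fin p) (Fin p) ℝ) (s : Fin p → ℝ)
    (j : Fin p) (x : (Fin p → ℝ) × (Fin p → ℝ)) :
    normalDensity (jointCov V s) (Sum.elim (swapPair j x).1 (swapPair j x).2) =
      normalDensity (jointCov V s) (Sum.elim x.1 x.2) := by
  rw [sumElim_swapPair, normalDensity_comp_equiv _ (jointCov_submatrix_swap s j)]

/-! ### Measurable families of measures -/

section Parametrized

variable {T E : Type*} [MeasurableSpace T] [MeasurableSpace E]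

/-- The measures `κ t` are images of measures with finite densities with respect to a common
measure, the densities and maps depending measurably on `t`.  Unlike measurability of `κ`, this
passes to products of σ-finite measures. -/
def IsParametrized (κ : T → Measure E) : Prop :=
  ∃ (b : Measure E) (w : T × E → ℝ≥0∞) (φ : T × E → E), SigmaFinite b ∧ Measurable w ∧
    Measurable φ ∧ (∀ a, w a ≠ ∞) ∧
    ∀ t, κ t = (b.withDensity fun u => w (t, u)).map fun u => φ (t, u)

theorem isParametrized_const (b : Measure E) [SigmaFinite b] : IsParametrized fun _ : T => b :=
  ⟨b, 1, Prod.snd, inferInstance, measurable_one, measurable_snd, fun _ => ENNReal.one_ne_top,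
    fun _ => by simp [Measure.map_id', ← Pi.one_def]⟩

namespace IsParametrized

theorem comp {T' : Type*} [MeasurableSpace T'] {κ : T → Measure E} (h : IsParametrized κ)
    {ζ : T' → T} (hζ : Measurable ζ) : IsParametrized fun t => κ (ζ t) := by
  obtain ⟨b, w, φ, hb, hw, hφ, hwt, hκ⟩ := h
  exact ⟨b, fun a => w (ζ a.1, a.2), fun a => φ (ζ a.1, a.2), hb, by fun_prop, by fun_prop,
    fun _ => hwt _, fun t => hκ (ζ t)⟩

theorem measurable_lintegral {κ : T → Measure E} (h : IsParametrized κ) {G : T × E → ℝ≥0∞}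
    (hG : Measurable G) : Measurable fun t => ∫⁻ x, G (t, x) ∂(κ t) := by
  obtain ⟨b, w, φ, hb, hw, hφ, -, hκ⟩ := h
  have unfold_param (t : T) :
      ∫⁻ x, G (t, x) ∂(κ t) = ∫⁻ u, w (t, u) * G (t, φ (t, u)) ∂b := by
    rw [hκ, lintegral_map (by fun_prop) (by fun_prop)]
    exact lintegral_withDensity_eq_lintegral_mul _ (by fun_prop) (by fun_prop)
  simp_rw [unfold_param]
  fun_prop

theorem measurable {κ : T → Measure E} (h : IsParametrized κ) : Measurable κ := by
  refine Measure.measurable_of_measurable_coe _ fun s hs => ?_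
  simpa [lintegral_indicator_one hs] using
    h.measurable_lintegral (G := fun a => s.indicator 1 a.2) (by fun_prop (disch := assumption))

theorem pi {n : Type*} [Fintype n] {E : n → Type*} [∀ j, MeasurableSpace (E j)]
    {κ : ∀ j, T → Measure (E j)} [∀ j t, SigmaFinite (κ j t)]
    (h : ∀ j, IsParametrized (κ j)) : IsParametrized fun t => Measure.pi fun j => κ j t := by
  choose b w φ hb hw hφ hwt hκ using h
  refine ⟨Measure.pi b, fun a => ∏ j, w j (a.1, a.2 j), fun a j => φ j (a.1, a.2 j),
    inferInstance, by fun_prop, by fun_prop,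
    fun a => ENNReal.prod_ne_top fun j _ => hwt j _, fun t => ?_⟩
  have (j : n) : SigmaFinite ((b j).withDensity fun u => w j (t, u)) :=
    SigmaFinite.withDensity_of_ne_top (Filter.Eventually.of_forall fun u => hwt j _)
  have (j : n) : SigmaFinite (((b j).withDensity fun u => w j (t, u)).map fun u => φ j (t, u)) := by
    rw [← hκ]
    infer_instance
  simp_rw [hκ]
  rw [← Measure.pi_map_pi fun j => by fun_prop, pi_withDensity b fun j => by fun_prop]

end IsParametrized

end Parametrized

/-! ### Fibres of the transformations -/

/-- The possible values of a predictor. -/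
def PredictorKind.values : PredictorKind → Set ℝ
  | .continuous => Set.univ
  | .categorical K => Set.range fun k : Fin (K + 1) => ((k : ℕ) : ℝ)

/-- The measure with respect to which a predictor has a density: Lebesgue measure for a continuous
predictor, and counting measure on the values for a categorical one. -/
def PredictorKind.refMeasure : PredictorKind → Measure ℝ
  | .continuous => volume
  | .categorical K => Measure.sum fun k : Fin (K + 1) => Measure.dirac ((k : ℕ) : ℝ)

instance (κ : PredictorKind) : SigmaFinite κ.refMeasure := by
  cases κ <;> unfold PredictorKind.refMeasure <;> infer_instance

namespace Transform

variable {κ : PredictorKind} (T : Transform κ)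

@[fun_prop]
theorem measurable_toFun : Measurable T.toFun := by
  cases T with
  | affine c d hd => exact (measurable_id.const_mul d).const_add c
  | cuts c hc =>
    unfold toFun
    simp_rw [Finset.card_filter]
    push_cast
    exact Finset.measurable_sum _ fun k _ =>
      Measurable.ite measurableSet_Ioi measurable_const measurable_const

theorem toFun_mem_values (x : ℝ) : T.toFun x ∈ κ.values := by
  cases T with
  | affine c d hd => trivial
  | @cuts K c hc =>
    exact ⟨⟨_, Nat.lt_succ_of_le ((Finset.card_filter_le _ _).trans (Finset.card_fin K).le)⟩, rfl⟩

theorem toFun_cuts_eq {K k : ℕ} (hk : k ≤ K) {c : Fin K → ℝ} (hc : StrictMono c) {x : ℝ}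
    (below : ∀ i : Fin K, i < k → c i < x) (above : ∀ i : Fin K, k ≤ i → x ≤ c i) :
    (cuts c hc).toFun x = k := by
  have h (i : Fin K) : c i < x ↔ i < k :=
    ⟨fun hi => not_le.mp fun hki => (above i hki).not_gt hi, below i⟩
  simp [toFun, h, Fin.card_filter_val_lt, hk]

instance (z : ℝ) : SigmaFinite (T.fibre z) := by
  cases T with
  | affine c d hd =>
    have : IsFiniteMeasure ((affine c d hd).fibre z) :=
      Measure.smul_finite _ ENNReal.ofReal_ne_top
    infer_instance
  | cuts c hc => unfold fibre; infer_instance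

theorem isParametrized_fibre : IsParametrized T.fibre := by
  cases T with
  | affine c d hd =>
    refine ⟨Measure.dirac 0, fun _ => ENNReal.ofReal d⁻¹, fun a => (a.1 - c) / d, inferInstance,
      by fun_prop, by fun_prop, fun _ => ENNReal.ofReal_ne_top, fun z => ?_⟩
    simp [fibre, withDensity_const]
  | cuts c hc =>
    have hgraph : MeasurableSet {a : ℝ × ℝ | (cuts c hc).toFun a.2 = a.1} :=
      measurableSet_eq_fun (by fun_prop) (by fun_prop)
    refine ⟨volume, {a : ℝ × ℝ | (cuts c hc).toFun a.2 = a.1}.indicator 1, Prod.snd, inferInstance,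
      measurable_one.indicator hgraph, measurable_snd, fun a => ?_, fun z => ?_⟩
    · exact ne_top_of_le_ne_top ENNReal.one_ne_top (Set.indicator_le_self' (by simp) a)
    · have hslice : MeasurableSet {x | (cuts c hc).toFun x = z} :=
        measurable_prodMk_left (x := z) hgraph
      rw [Measure.map_id', fibre, ← withDensity_indicator_one hslice]
      rfl

theorem ae_fibre (z : ℝ) : ∀ᵐ x ∂(T.fibre z), T.toFun x = z := by
  cases T with
  | affine c d hd =>
    refine Measure.ae_smul_measure ?_ _
    rw [ae_dirac_eq]
    change c + d * ((z - c) / d) = z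
    field_simp
    ring
  | cuts c hc => exact ae_restrict_mem ((cuts c hc).measurable_toFun (measurableSet_singleton z))

theorem bind_fibre : κ.refMeasure.bind T.fibre = volume := by
  ext s hs
  rw [Measure.bind_apply hs T.isParametrized_fibre.measurable.aemeasurable]
  cases T with
  | affine c d hd =>
    simp only [PredictorKind.refMeasure, fibre, Measure.smul_apply, smul_eq_mul,
      Measure.dirac_apply' _ hs]
    rw [lintegral_const_mul' _ _ ENNReal.ofReal_ne_top,
      lintegral_sub_right_eq_self (fun z => s.indicator (1 : ℝ → ℝ≥0∞) (z / d)) c]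
    simp_rw [div_eq_inv_mul]
    rw [← lintegral_map (measurable_one.indicator hs) (measurable_const_mul d⁻¹),
      Real.map_volume_mul_left (inv_ne_zero hd.ne'), lintegral_smul_measure,
      lintegral_indicator_one hs, inv_inv, abs_of_pos hd, smul_eq_mul, ← mul_assoc,
      ← ENNReal.ofReal_mul (by positivity), inv_mul_cancel₀ hd.ne', ENNReal.ofReal_one, one_mul]
  | @cuts K c hc =>
    simp only [PredictorKind.refMeasure, fibre, lintegral_sum_measure, tsum_fintype,
      lintegral_dirac, Measure.restrict_apply hs]
    rw [← measure_biUnion_finset]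
    · congr 1
      ext x
      obtain ⟨k, hk⟩ := (cuts c hc).toFun_mem_values x
      simpa using fun _ => ⟨k, hk.symm⟩
    · refine fun k _ k' _ hkk => Set.disjoint_left.mpr fun x hx hx' => hkk (Fin.ext ?_)
      exact_mod_cast hx.2.symm.trans hx'.2
    · exact fun k _ => hs.inter ((cuts c hc).measurable_toFun (measurableSet_singleton _))

theorem fibre_ne_zero {z : ℝ} (hz : z ∈ κ.values) : T.fibre z ≠ 0 := by
  rw [← Measure.measure_univ_ne_zero]
  cases T with
  | affine c d hd => simp [fibre, hd]
  | @cuts K c hc =>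
    obtain ⟨k, rfl⟩ := hz
    obtain ⟨x, below, above⟩ := Order.exists_between_finsets
      (Finset.image c {i : Fin K | i < (k : ℕ)}) (Finset.image c {i : Fin K | (k : ℕ) ≤ i}) (by
        simp only [Finset.forall_mem_image, Finset.mem_filter_univ]
        exact fun i hi i' hi' => hc (Fin.lt_def.mpr (hi.trans_le hi')))
    simp only [Finset.forall_mem_image, Finset.mem_filter_univ] at below above
    have hnhds : {x | (cuts c hc).toFun x = (k : ℕ)} ∈ nhds x := by
      have below_near : ∀ᶠ y in nhds x, ∀ i : Fin K, i < (k : ℕ) → c i < y := by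
        simp only [Filter.eventually_all]
        exact fun i hi => lt_mem_nhds (below hi)
      have above_near : ∀ᶠ y in nhds x, ∀ i : Fin K, (k : ℕ) ≤ i → y ≤ c i := by
        simp only [Filter.eventually_all]
        exact fun i hi => ge_mem_nhds (above hi)
      filter_upwards [below_near, above_near] with y hy hy'
      exact toFun_cuts_eq (Nat.lt_succ_iff.mp k.2) hc hy hy'
    simpa [fibre] using (Measure.measure_pos_of_mem_nhds volume hnhds).ne'

theorem lintegral_exp_fibre_ne_top {c : ℝ} (hc : 0 < c) (z : ℝ) :
    ∫⁻ x, ENNReal.ofReal (Real.exp (-c * x ^ 2)) ∂(T.fibre z) ≠ ∞ := by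
  cases T with
  | affine c' d hd =>
    simp only [fibre, lintegral_smul_measure, lintegral_dirac, smul_eq_mul]
    exact ENNReal.mul_ne_top ENNReal.ofReal_ne_top ENNReal.ofReal_ne_top
  | cuts c' hc' =>
    exact ((setLIntegral_le_lintegral _ _).trans_lt
      (integrable_exp_neg_mul_sq hc).lintegral_lt_top).ne

end Transform

/-! ### The measurement model -/

namespace Items

variable {ι : Type*} (I : Items ι)

theorem prob_pos (l : ι) (t : ℝ) (k : ℕ) : 0 < I.prob l t k :=
  div_pos (Real.exp_pos _) (Finset.sum_pos (fun _ _ => Real.exp_pos _) (by simp))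

theorem prob_le_one (l : ι) (t : ℝ) (k : Fin (I.K l + 1)) : I.prob l t k ≤ 1 :=
  div_le_one_of_le₀
    (Finset.single_le_sum (f := fun m => Real.exp (∑ r ∈ Finset.Icc 1 m, (I.a l * t + I.b l r)))
      (fun _ _ => (Real.exp_pos _).le) (Finset.mem_range.mpr k.2))
    (Finset.sum_nonneg fun _ _ => (Real.exp_pos _).le)

@[fun_prop]
theorem measurable_prob (l : ι) (k : ℕ) : Measurable fun t => I.prob l t k := by
  unfold Items.prob
  fun_prop

variable {I} {B : Finset ι}

@[fun_prop]
theorem measurable_respProb (y : I.Resp B) : Measurable fun t => I.respProb t y := by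
  unfold respProb
  fun_prop

theorem respProb_ne_zero (y : I.Resp B) (t : ℝ) : I.respProb t y ≠ 0 :=
  Finset.prod_ne_zero_iff.mpr fun l _ => by simpa using I.prob_pos l t (y l)

theorem respProb_le_one (y : I.Resp B) (t : ℝ) : I.respProb t y ≤ 1 :=
  Finset.prod_le_one' fun l _ => by simpa using I.prob_le_one l t (y l)

end Items

/-! ### Observed parts -/

section Model

variable {p : ℕ} {kind : Fin p → PredictorKind} {ι : Type*} {I : Items ι} {B : Finset ι}

theorem mask_mask (α : Finset (Fin p)) (z : Fin p → ℝ) : mask α (mask α z) = mask α z := by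
  funext j
  by_cases h : j ∈ α <;> simp [mask, h]

theorem mask_eq_self {α : Finset (Fin p)} {z : Fin p → ℝ} (h : ∀ j, j ∉ α → z j = 0) :
    mask α z = z := by
  funext j
  by_cases hj : j ∈ α <;> simp [mask, hj, h]

@[fun_prop]
theorem measurable_mask {T : Type*} [MeasurableSpace T] {A : T → Finset (Fin p)}
    {z : T → Fin p → ℝ} (hA : Measurable A) (hz : Measurable z) :
    Measurable fun t => mask (A t) (z t) := by
  have mask_fixed (α : Finset (Fin p)) : Measurable (mask α) :=
    measurable_pi_lambda _ fun j => by
      by_cases h : j ∈ α <;> simp only [mask, h, if_true, if_false] <;> fun_prop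
  have mask_joint : Measurable fun b : Finset (Fin p) × (Fin p → ℝ) => mask b.1 b.2 :=
    measurable_from_prod_countable_right mask_fixed
  exact mask_joint.comp (hA.prodMk hz)

theorem SMAR.mask_apply {S : Set (Fin p)} {q : (Fin p → ℝ) → PMF (Finset (Fin p))}
    (hq : SMAR S q) (α : Finset (Fin p)) (z : Fin p → ℝ) : q (mask α z) α = q z α :=
  hq α _ _ fun k hk _ => by simp [mask, hk]

/-- The measure with respect to which `(Z_j)_{j ∈ α}` has a density; the missing entries are
set to `0`. -/
def refMeasure (kind : Fin p → PredictorKind) (α : Finset (Fin p)) : Measure (Fin p → ℝ) :=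
  Measure.pi fun j => if j ∈ α then (kind j).refMeasure else Measure.dirac 0

instance (α : Finset (Fin p)) (j : Fin p) :
    SigmaFinite (if j ∈ α then (kind j).refMeasure else Measure.dirac 0) := by
  split_ifs <;> infer_instance

instance (α : Finset (Fin p)) : SigmaFinite (refMeasure kind α) := by
  unfold refMeasure
  infer_instance

theorem ae_mask_eq_self_refMeasure (α : Finset (Fin p)) :
    ∀ᵐ z ∂(refMeasure kind α), mask α z = z := by
  have missing_eq_zero (j : Fin p) :
      ∀ᵐ t ∂(if j ∈ α then (kind j).refMeasure else Measure.dirac 0), j ∉ α → t = 0 := by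
    by_cases hj : j ∈ α <;> simp [hj, ae_dirac_eq]
  filter_upwards [ae_pi_forall missing_eq_zero] with z hz
  exact mask_eq_self hz

namespace Params

variable (M : Params kind)

@[fun_prop]
theorem measurable_predictors : Measurable M.predictors :=
  measurable_pi_lambda _ fun j => (M.transf j).measurable_toFun.comp (measurable_pi_apply j)

theorem predictors_mem_values (x : Fin p → ℝ) (j : Fin p) : M.predictors x j ∈ (kind j).values :=
  (M.transf j).toFun_mem_values _

/-! ### Fibres of the predictors -/

/-- The factors of the product measure `Params.fibre`. -/
def coordFibre (α : Finset (Fin p)) (j : Fin p) (z : ℝ) : Measure ℝ :=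
  if j ∈ α then (M.transf j).fibre z else volume

theorem fibre_eq_pi (α : Finset (Fin p)) (z : Fin p → ℝ) :
    M.fibre α z = Measure.pi fun j => M.coordFibre α j (z j) := rfl

instance (α : Finset (Fin p)) (j : Fin p) (z : ℝ) : SigmaFinite (M.coordFibre α j z) := by
  unfold coordFibre
  split_ifs <;> infer_instance

instance (α : Finset (Fin p)) (z : Fin p → ℝ) : SigmaFinite (M.fibre α z) := by
  rw [fibre_eq_pi]
  infer_instance

theorem isParametrized_coordFibre (α : Finset (Fin p)) (j : Fin p) :
    IsParametrized (M.coordFibre α j) := by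
  unfold coordFibre
  split_ifs
  · exact (M.transf j).isParametrized_fibre
  · exact isParametrized_const volume

theorem isParametrized_fibre (α : Finset (Fin p)) : IsParametrized (M.fibre α) :=
  .pi (κ := fun j (z : Fin p → ℝ) => M.coordFibre α j (z j)) fun j =>
    (M.isParametrized_coordFibre α j).comp (measurable_pi_apply j)

theorem fibre_congr {α : Finset (Fin p)} {z z' : Fin p → ℝ} (h : ∀ j ∈ α, z j = z' j) :
    M.fibre α z = M.fibre α z' := by
  unfold fibre
  congr! 2 with j
  split_ifs with hj
  · rw [h j hj]
  · rfl

theorem fibre_update (α : Finset (Fin p)) (z : Fin p → ℝ) (j : Fin p) (t : ℝ) :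
    M.fibre α (Function.update z j t) = Measure.pi
      (Function.update (fun k => M.coordFibre α k (z k)) j (M.coordFibre α j t)) := by
  rw [fibre_eq_pi]
  congr 1
  funext k
  rcases eq_or_ne k j with rfl | hk <;> simp [*]

theorem bind_coordFibre (α : Finset (Fin p)) (j : Fin p) :
    (if j ∈ α then (kind j).refMeasure else Measure.dirac 0).bind (M.coordFibre α j) =
      volume := by
  unfold coordFibre
  split_ifs
  · exact (M.transf j).bind_fibre
  · exact Measure.dirac_bind measurable_const 0

theorem bind_fibre (α : Finset (Fin p)) : (refMeasure kind α).bind (M.fibre α) = volume := by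
  have (j : Fin p) : SigmaFinite
      ((if j ∈ α then (kind j).refMeasure else Measure.dirac 0).bind (M.coordFibre α j)) := by
    rw [bind_coordFibre]
    infer_instance
  calc (refMeasure kind α).bind (M.fibre α)
      = Measure.pi fun j =>
          (if j ∈ α then (kind j).refMeasure else Measure.dirac 0).bind (M.coordFibre α j) :=
        bind_pi (κ := M.coordFibre α) _ (fun j => (M.isParametrized_coordFibre α j).measurable)
          (M.isParametrized_fibre α).measurable
    _ = volume := by simp only [bind_coordFibre, volume_pi]

theorem ae_mask_predictors_eq (α : Finset (Fin p)) (z : Fin p → ℝ) :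
    ∀ᵐ x ∂(M.fibre α z), mask α (M.predictors x) = mask α z := by
  have observed_eq (j : Fin p) :
      ∀ᵐ t ∂(M.coordFibre α j (z j)), j ∈ α → (M.transf j).toFun t = z j := by
    by_cases hj : j ∈ α
    · simpa [coordFibre, hj] using (M.transf j).ae_fibre (z j)
    · simp [hj]
  rw [fibre_eq_pi]
  filter_upwards [ae_pi_forall observed_eq] with x hx
  funext j
  by_cases hj : j ∈ α
  · simpa [mask, hj, predictors] using hx j hj
  · simp [mask, hj]

theorem lintegral_mask_predictors (α : Finset (Fin p)) {G : (Fin p → ℝ) → (Fin p → ℝ) → ℝ≥0∞}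
    (hG : Measurable fun x => G (mask α (M.predictors x)) x) :
    ∫⁻ x, G (mask α (M.predictors x)) x =
      ∫⁻ z, ∫⁻ x, G z x ∂(M.fibre α z) ∂(refMeasure kind α) := by
  rw [← M.bind_fibre α, Measure.lintegral_bind (M.isParametrized_fibre α).measurable.aemeasurable
    hG.aemeasurable]
  refine lintegral_congr_ae ?_
  filter_upwards [ae_mask_eq_self_refMeasure α] with z hz
  refine lintegral_congr_ae ?_
  filter_upwards [M.ae_mask_predictors_eq α z] with x hx
  rw [hx, hz]

theorem fibre_ne_zero {α : Finset (Fin p)} {z : Fin p → ℝ}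
    (hz : ∀ j ∈ α, z j ∈ (kind j).values) : M.fibre α z ≠ 0 := by
  rw [← Measure.measure_univ_ne_zero, fibre_eq_pi, ← Set.pi_univ, Measure.pi_pi]
  refine Finset.prod_ne_zero_iff.mpr fun j _ => ?_
  rw [Measure.measure_univ_ne_zero, coordFibre]
  split_ifs with hj
  · exact (M.transf j).fibre_ne_zero (hz j hj)
  · exact NeZero.ne _

theorem lintegral_exp_fibre_ne_top (α : Finset (Fin p)) (z : Fin p → ℝ) {c : ℝ} (hc : 0 < c) :
    ∫⁻ x, ∏ j, ENNReal.ofReal (Real.exp (-c * x j ^ 2)) ∂(M.fibre α z) ≠ ∞ := by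
  rw [fibre_eq_pi, lintegral_pi_prod _ (f := fun _ t => ENNReal.ofReal (Real.exp (-c * t ^ 2)))
    fun _ => by fun_prop]
  refine ENNReal.prod_ne_top fun j _ => ?_
  unfold coordFibre
  split_ifs
  · exact (M.transf j).lintegral_exp_fibre_ne_top hc _
  · exact (integrable_exp_neg_mul_sq hc).lintegral_lt_top.ne

/-! ### Response probabilities -/

@[fun_prop]
theorem measurable_regressor (κ : PredictorKind) (k : Fin κ.dim) :
    Measurable fun z => κ.regressor z k := by
  cases κ with
  | continuous => exact measurable_id
  | categorical K => exact Measurable.ite measurableSet_Ici measurable_const measurable_const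

@[fun_prop]
theorem measurable_abilityMean : Measurable M.abilityMean := by
  unfold abilityMean
  fun_prop

@[fun_prop]
theorem measurable_respDensity (y : I.Resp B) : Measurable (M.respDensity I y) := by
  have translate (z : Fin p → ℝ) : M.respDensity I y z =
      ∫⁻ t, I.respProb (M.abilityMean z + t) y ∂(gaussianReal 0 M.resVar) := by
    rw [← lintegral_map (f := fun t => I.respProb t y) (by fun_prop)
      (measurable_const_add (M.abilityMean z)), gaussianReal_map_const_add, zero_add, respDensity]
  rw [funext translate]
  fun_prop

theorem respDensity_ne_zero (y : I.Resp B) (z : Fin p → ℝ) : M.respDensity I y z ≠ 0 := by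
  rw [respDensity, Ne, lintegral_eq_zero_iff (by fun_prop)]
  intro h
  obtain ⟨t, ht⟩ := h.exists
  exact Items.respProb_ne_zero y t ht

theorem respDensity_le_one (y : I.Resp B) (z : Fin p → ℝ) : M.respDensity I y z ≤ 1 :=
  calc M.respDensity I y z
      ≤ ∫⁻ _, 1 ∂(gaussianReal (M.abilityMean z) M.resVar) :=
        lintegral_mono fun t => Items.respProb_le_one y t
    _ = 1 := by simp

theorem respDensity_ne_top (y : I.Resp B) (z : Fin p → ℝ) : M.respDensity I y z ≠ ∞ :=
  ne_top_of_le_ne_top ENNReal.one_ne_top (M.respDensity_le_one y z)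

theorem respDensity_congr (y : I.Resp B) {z z' : Fin p → ℝ} (h : ∀ j ∈ M.nonNull, z j = z' j) :
    M.respDensity I y z = M.respDensity I y z' := by
  have mean_eq : M.abilityMean z = M.abilityMean z' := by
    unfold abilityMean
    congr 1
    refine Finset.sum_congr rfl fun j _ => ?_
    by_cases hj : M.slope j = 0
    · simp [hj]
    · rw [h j hj]
  rw [respDensity, respDensity, mean_eq]

/-! ### Densities of the data and the knockoffs -/

/-- The joint density of the underlying variables at `x` and the responses at `y`: the integrand of
`Params.obsDensity`. -/
def latentDensity (M : Params kind) (y : I.Resp B) (x : Fin p → ℝ) : ℝ≥0∞ :=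
  normalDensity M.corr x * M.respDensity I y (M.predictors x)

/-- The joint density of the underlying variables at `a.1`, their knockoffs at `a.2` and the
responses at `y`: the integrand of `Params.jointDensity`. -/
def latentJointDensity (M : Params kind) (s : Fin p → ℝ) (y : I.Resp B)
    (a : (Fin p → ℝ) × (Fin p → ℝ)) : ℝ≥0∞ :=
  normalDensity (jointCov M.corr s) (Sum.elim a.1 a.2) * M.respDensity I y (M.predictors a.1)

@[fun_prop]
theorem measurable_latentDensity (y : I.Resp B) : Measurable (M.latentDensity y) := by
  unfold latentDensity
  fun_prop

theorem latentDensity_ne_zero (y : I.Resp B) (x : Fin p → ℝ) : M.latentDensity y x ≠ 0 :=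
  mul_ne_zero (normalDensity_ne_zero M.corr_posDef x) (M.respDensity_ne_zero y _)

theorem latentDensity_ne_top (y : I.Resp B) (x : Fin p → ℝ) : M.latentDensity y x ≠ ∞ :=
  ENNReal.mul_ne_top (normalDensity_ne_top _ _) (M.respDensity_ne_top y _)

@[fun_prop]
theorem measurable_latentJointDensity (s : Fin p → ℝ) (y : I.Resp B) :
    Measurable (M.latentJointDensity s y) := by
  unfold latentJointDensity
  fun_prop

theorem latentJointDensity_swapPair {j : Fin p} (hj : j ∉ M.nonNull) (s : Fin p → ℝ)
    (y : I.Resp B) (a : (Fin p → ℝ) × (Fin p → ℝ)) :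
    M.latentJointDensity s y (swapPair j a) = M.latentJointDensity s y a := by
  rw [latentJointDensity, latentJointDensity, normalDensity_jointCov_swapPair]
  congr 1
  refine M.respDensity_congr y fun k hk => ?_
  simp [predictors, swapPair, ne_of_mem_of_not_mem hk hj]

theorem obsDensity_eq_lintegral (α : Finset (Fin p)) (z : Fin p → ℝ) (y : I.Resp B) :
    M.obsDensity I α z y = ∫⁻ x, M.latentDensity y x ∂(M.fibre α z) := rfl

theorem jointDensity_eq_lintegral (s : Fin p → ℝ) (α : Finset (Fin p)) (z zt : Fin p → ℝ)
    (y : I.Resp B) : M.jointDensity s I α z zt y =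
      ∫⁻ x, ∫⁻ xt, M.latentJointDensity s y (x, xt) ∂(M.fibre α zt) ∂(M.fibre α z) := rfl

theorem jointDensity_eq_lintegral_prod (s : Fin p → ℝ) (α : Finset (Fin p)) (z zt : Fin p → ℝ)
    (y : I.Resp B) : M.jointDensity s I α z zt y =
      ∫⁻ a, M.latentJointDensity s y a ∂((M.fibre α z).prod (M.fibre α zt)) :=
  (lintegral_prod _ (M.measurable_latentJointDensity s y).aemeasurable).symm

@[fun_prop]
theorem measurable_obsDensity (α : Finset (Fin p)) (y : I.Resp B) :
    Measurable fun z => M.obsDensity I α z y :=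
  (M.isParametrized_fibre α).measurable_lintegral (G := fun a => M.latentDensity y a.2)
    (by fun_prop)

@[fun_prop]
theorem measurable_jointDensity (s : Fin p → ℝ) (α : Finset (Fin p)) (y : I.Resp B) :
    Measurable fun a : (Fin p → ℝ) × (Fin p → ℝ) => M.jointDensity s I α a.1 a.2 y := by
  have inner : Measurable fun b : ((Fin p → ℝ) × (Fin p → ℝ)) × (Fin p → ℝ) =>
      ∫⁻ xt, M.latentJointDensity s y (b.2, xt) ∂(M.fibre α b.1.2) :=
    ((M.isParametrized_fibre α).comp (measurable_snd.comp measurable_fst)).measurable_lintegral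
      (G := fun c => M.latentJointDensity s y (c.1.2, c.2)) (by fun_prop)
  exact ((M.isParametrized_fibre α).comp measurable_fst).measurable_lintegral inner

theorem obsDensity_congr {α : Finset (Fin p)} {z z' : Fin p → ℝ} (h : ∀ j ∈ α, z j = z' j)
    (y : I.Resp B) : M.obsDensity I α z y = M.obsDensity I α z' y := by
  rw [obsDensity, obsDensity, M.fibre_congr h]

theorem jointDensity_congr (s : Fin p → ℝ) {α : Finset (Fin p)} {z z' zt zt' : Fin p → ℝ}
    (h : ∀ j ∈ α, z j = z' j) (ht : ∀ j ∈ α, zt j = zt' j) (y : I.Resp B) :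
    M.jointDensity s I α z zt y = M.jointDensity s I α z' zt' y := by
  rw [jointDensity, jointDensity, M.fibre_congr h, M.fibre_congr ht]

theorem obsDensity_ne_zero {α : Finset (Fin p)} {z : Fin p → ℝ}
    (hz : ∀ j ∈ α, z j ∈ (kind j).values) (y : I.Resp B) : M.obsDensity I α z y ≠ 0 := by
  have := ae_neBot.mpr (M.fibre_ne_zero hz)
  rw [obsDensity_eq_lintegral, Ne, lintegral_eq_zero_iff (by fun_prop)]
  intro h
  obtain ⟨x, hx⟩ := h.exists
  exact M.latentDensity_ne_zero y x hx

theorem obsDensity_ne_top (α : Finset (Fin p)) (z : Fin p → ℝ) (y : I.Resp B) :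
    M.obsDensity I α z y ≠ ∞ := by
  obtain ⟨C, c, hC, hc, h⟩ := exists_normalDensity_le M.corr_posDef
  refine ne_top_of_le_ne_top
    (ENNReal.mul_ne_top hC (M.lintegral_exp_fibre_ne_top α z hc)) ?_
  rw [← lintegral_const_mul' _ _ hC]
  exact lintegral_mono fun x => (mul_le_of_le_one_right' (M.respDensity_le_one y _)).trans (h x)

theorem jointDensity_ne_zero {s : Fin p → ℝ} (hs : (jointCov M.corr s).PosDef)
    {α : Finset (Fin p)} {z zt : Fin p → ℝ} (hz : ∀ j ∈ α, z j ∈ (kind j).values)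
    (hzt : ∀ j ∈ α, zt j ∈ (kind j).values) (y : I.Resp B) :
    M.jointDensity s I α z zt y ≠ 0 := by
  have := ae_neBot.mpr (M.fibre_ne_zero hz)
  have := ae_neBot.mpr (M.fibre_ne_zero hzt)
  rw [jointDensity_eq_lintegral_prod, Ne, lintegral_eq_zero_iff (by fun_prop)]
  intro h
  obtain ⟨x, hx⟩ := (Measure.ae_ae_of_ae_prod h).exists
  obtain ⟨xt, hxt⟩ := hx.exists
  exact mul_ne_zero (normalDensity_ne_zero hs _) (M.respDensity_ne_zero y _) hxt

theorem jointDensity_ne_top {s : Fin p → ℝ} (hs : (jointCov M.corr s).PosDef)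
    (α : Finset (Fin p)) (z zt : Fin p → ℝ) (y : I.Resp B) :
    M.jointDensity s I α z zt y ≠ ∞ := by
  obtain ⟨C, c, hC, hc, h⟩ := exists_normalDensity_le hs
  have measurable_bound :
      Measurable fun x : Fin p → ℝ => ∏ j, ENNReal.ofReal (Real.exp (-c * x j ^ 2)) := by
    fun_prop
  refine ne_top_of_le_ne_top (ENNReal.mul_ne_top hC (ENNReal.mul_ne_top
    (M.lintegral_exp_fibre_ne_top α z hc) (M.lintegral_exp_fibre_ne_top α zt hc))) ?_
  rw [jointDensity_eq_lintegral_prod,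
    ← lintegral_prod_mul measurable_bound.aemeasurable measurable_bound.aemeasurable,
    ← lintegral_const_mul' _ _ hC]
  refine lintegral_mono fun a => (mul_le_of_le_one_right' (M.respDensity_le_one y _)).trans
    ((h _).trans_eq ?_)
  rw [Fintype.prod_sum_type]
  rfl

theorem jointDensity_swapPair {j : Fin p} (hj : j ∉ M.nonNull) (s : Fin p → ℝ)
    (α : Finset (Fin p)) (a : (Fin p → ℝ) × (Fin p → ℝ)) (y : I.Resp B) :
    M.jointDensity s I α (swapPair j a).1 (swapPair j a).2 y =
      M.jointDensity s I α a.1 a.2 y := by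
  have swap_fibres : MeasurePreserving (swapPair j) ((M.fibre α a.1).prod (M.fibre α a.2))
      ((M.fibre α (swapPair j a).1).prod (M.fibre α (swapPair j a).2)) := by
    simp only [swapPair, fibre_update]
    exact measurePreserving_swapPair j (fun k => M.coordFibre α k (a.1 k))
      (fun k => M.coordFibre α k (a.2 k))
  rw [jointDensity_eq_lintegral_prod, jointDensity_eq_lintegral_prod,
    ← swap_fibres.lintegral_comp (by fun_prop)]
  simp only [M.latentJointDensity_swapPair hj]

/-! ### Conditional law of the knockoffs -/

@[fun_prop]
theorem measurable_knockoffDensity (s : Fin p → ℝ) (α : Finset (Fin p)) (y : I.Resp B) :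
    Measurable fun a : (Fin p → ℝ) × (Fin p → ℝ) => M.knockoffDensity s I α a.1 a.2 y :=
  (M.measurable_jointDensity s α y).div ((M.measurable_obsDensity α y).comp measurable_fst)

theorem lintegral_knockoffKernel (s x : Fin p → ℝ) {g : (Fin p → ℝ) → ℝ≥0∞} (hg : Measurable g) :
    ∫⁻ xt, g xt ∂(M.knockoffKernel s x) =
      ∫⁻ xt, normalDensity (jointCov M.corr s) (Sum.elim x xt) / normalDensity M.corr x * g xt := by
  have density_measurable : Measurable fun xt =>
      normalDensity (jointCov M.corr s) (Sum.elim x xt) / normalDensity M.corr x := by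
    fun_prop
  rw [knockoffKernel, lintegral_withDensity_eq_lintegral_mul _ density_measurable hg]
  rfl

@[fun_prop]
theorem measurable_lintegral_knockoffKernel (s : Fin p → ℝ) {T : Type*} [MeasurableSpace T]
    {g : T × (Fin p → ℝ) → ℝ≥0∞} (hg : Measurable g) {ξ : T → Fin p → ℝ} (hξ : Measurable ξ) :
    Measurable fun t => ∫⁻ xt, g (t, xt) ∂(M.knockoffKernel s (ξ t)) := by
  simp_rw [fun t => M.lintegral_knockoffKernel s (ξ t) (g := fun xt => g (t, xt)) (by fun_prop)]
  fun_prop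

theorem latentDensity_mul_lintegral_knockoffKernel (s : Fin p → ℝ) (y : I.Resp B)
    (x : Fin p → ℝ) {g : (Fin p → ℝ) → ℝ≥0∞} (hg : Measurable g) :
    M.latentDensity y x * ∫⁻ xt, g xt ∂(M.knockoffKernel s x) =
      ∫⁻ xt, g xt * M.latentJointDensity s y (x, xt) := by
  rw [M.lintegral_knockoffKernel s x hg, ← lintegral_const_mul' _ _ (M.latentDensity_ne_top y x)]
  refine lintegral_congr fun xt => ?_
  have cancel : normalDensity M.corr x *
      (normalDensity (jointCov M.corr s) (Sum.elim x xt) / normalDensity M.corr x) =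
      normalDensity (jointCov M.corr s) (Sum.elim x xt) :=
    ENNReal.mul_div_cancel (normalDensity_ne_zero M.corr_posDef x) (normalDensity_ne_top _ _)
  calc M.latentDensity y x *
        (normalDensity (jointCov M.corr s) (Sum.elim x xt) / normalDensity M.corr x * g xt)
      = g xt * (normalDensity M.corr x *
          (normalDensity (jointCov M.corr s) (Sum.elim x xt) / normalDensity M.corr x) *
            M.respDensity I y (M.predictors x)) := by rw [latentDensity]; ring
    _ = g xt * M.latentJointDensity s y (x, xt) := by rw [cancel]; rfl

theorem lintegral_latentPosterior (α : Finset (Fin p)) (z : Fin p → ℝ) (y : I.Resp B)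
    {g : (Fin p → ℝ) → ℝ≥0∞} (hg : Measurable g) :
    ∫⁻ x, g x ∂(M.latentPosterior I α z y) =
      (M.obsDensity I α z y)⁻¹ * ∫⁻ x, M.latentDensity y x * g x ∂(M.fibre α z) := by
  rw [latentPosterior, lintegral_smul_measure, smul_eq_mul]
  congr 1
  exact lintegral_withDensity_eq_lintegral_mul _ (M.measurable_latentDensity y) hg

theorem lintegral_latentDensity_mul_knockoffKernel (s : Fin p → ℝ) (α : Finset (Fin p))
    (z : Fin p → ℝ) (y : I.Resp B) {g : (Fin p → ℝ) → ℝ≥0∞} (hg : Measurable g) :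
    ∫⁻ x, M.latentDensity y x *
        ∫⁻ xt, g (mask α (M.predictors xt)) ∂(M.knockoffKernel s x) ∂(M.fibre α z) =
      ∫⁻ zt, g zt * M.jointDensity s I α z zt y ∂(refMeasure kind α) := by
  have inner_measurable : Measurable fun b : (Fin p → ℝ) × (Fin p → ℝ) =>
      ∫⁻ xt, g b.2 * M.latentJointDensity s y (b.1, xt) ∂(M.fibre α b.2) :=
    ((M.isParametrized_fibre α).comp measurable_snd).measurable_lintegral
      (G := fun c => g c.1.2 * M.latentJointDensity s y (c.1.1, c.2)) (by fun_prop)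
  have knockoff_measurable (zt : Fin p → ℝ) : Measurable fun x =>
      ∫⁻ xt, M.latentJointDensity s y (x, xt) ∂(M.fibre α zt) :=
    (isParametrized_const (M.fibre α zt)).measurable_lintegral
      (M.measurable_latentJointDensity s y)
  calc ∫⁻ x, M.latentDensity y x *
        ∫⁻ xt, g (mask α (M.predictors xt)) ∂(M.knockoffKernel s x) ∂(M.fibre α z)
      = ∫⁻ x, ∫⁻ xt, g (mask α (M.predictors xt)) * M.latentJointDensity s y (x, xt)
          ∂volume ∂(M.fibre α z) :=
        lintegral_congr fun x => M.latentDensity_mul_lintegral_knockoffKernel s y x (by fun_prop)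
    _ = ∫⁻ x, ∫⁻ zt, ∫⁻ xt, g zt * M.latentJointDensity s y (x, xt) ∂(M.fibre α zt)
          ∂(refMeasure kind α) ∂(M.fibre α z) :=
        lintegral_congr fun x => M.lintegral_mask_predictors α
          (G := fun zt xt => g zt * M.latentJointDensity s y (x, xt)) (by fun_prop)
    _ = ∫⁻ zt, ∫⁻ x, ∫⁻ xt, g zt * M.latentJointDensity s y (x, xt) ∂(M.fibre α zt)
          ∂(M.fibre α z) ∂(refMeasure kind α) :=
        lintegral_lintegral_swap inner_measurable.aemeasurable
    _ = ∫⁻ zt, g zt * M.jointDensity s I α z zt y ∂(refMeasure kind α) := by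
        refine lintegral_congr fun zt => ?_
        rw [jointDensity_eq_lintegral, ← lintegral_const_mul _ (knockoff_measurable zt)]
        exact lintegral_congr fun x => lintegral_const_mul _ (by fun_prop)

theorem lintegral_latentPosterior_knockoffKernel (s : Fin p → ℝ) (α : Finset (Fin p))
    (z : Fin p → ℝ) (y : I.Resp B) {g : (Fin p → ℝ) → ℝ≥0∞} (hg : Measurable g) :
    ∫⁻ x, ∫⁻ xt, g (mask α (M.predictors xt)) ∂(M.knockoffKernel s x)
        ∂(M.latentPosterior I α z y) =
      ∫⁻ zt, g zt * M.knockoffDensity s I α z zt y ∂(refMeasure kind α) := by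
  have inner_measurable : Measurable fun x =>
      ∫⁻ xt, g (mask α (M.predictors xt)) ∂(M.knockoffKernel s x) :=
    M.measurable_lintegral_knockoffKernel s (g := fun b => g (mask α (M.predictors b.2)))
      (by fun_prop) measurable_id
  rw [M.lintegral_latentPosterior α z y inner_measurable,
    M.lintegral_latentDensity_mul_knockoffKernel s α z y hg,
    ← lintegral_const_mul _ (by fun_prop)]
  refine lintegral_congr fun zt => ?_
  rw [knockoffDensity, div_eq_mul_inv]
  ring

end Params

/-! ### Reference measure and density of the data of a student -/

instance : Fintype (I.Resp B) := Fintype.ofFinite _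

variable (I B) in
/-- The missingness pattern, observed predictors, observed knockoffs and responses of a student. -/
abbrev StudentData (p : ℕ) : Type _ :=
  Finset (Fin p) × ((Fin p → ℝ) × (Fin p → ℝ)) × I.Resp B

/-- The data of a student with missingness pattern `α`, complete predictors `z`, complete knockoffs
`zt` and responses `y`. -/
def observedData (α : Finset (Fin p)) (z zt : Fin p → ℝ) (y : I.Resp B) : StudentData I B p :=
  (α, (mask α z, mask α zt), y)

@[fun_prop]
theorem measurable_observedData {T : Type*} [MeasurableSpace T] {A : T → Finset (Fin p)}
    {z zt : T → Fin p → ℝ} {y : T → I.Resp B} (hA : Measurable A) (hz : Measurable z)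
    (hzt : Measurable zt) (hy : Measurable y) :
    Measurable fun t => observedData (A t) (z t) (zt t) (y t) := by
  unfold observedData
  fun_prop

theorem measurable_studentData {E : Type*} [MeasurableSpace E] {G : StudentData I B p → E}
    (h : ∀ α y, Measurable fun a => G (α, a, y)) : Measurable G :=
  measurable_from_prod_countable_right fun α => measurable_from_prod_countable_left (h α)

variable (I B) in
/-- The measure with respect to which the data of a student have a density. -/
def dataRefMeasure (kind : Fin p → PredictorKind) : Measure (StudentData I B p) :=
  Measure.sum fun a : Finset (Fin p) × I.Resp B =>
    (Measure.dirac a.1).prod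
      (((refMeasure kind a.1).prod (refMeasure kind a.1)).prod (Measure.dirac a.2))

instance : SigmaFinite (dataRefMeasure I B kind) := by
  unfold dataRefMeasure
  infer_instance

theorem lintegral_dataRefMeasure {F : StudentData I B p → ℝ≥0∞} (hF : Measurable F) :
    ∫⁻ e, F e ∂(dataRefMeasure I B kind) =
      ∑ α, ∑ y, ∫⁻ a, F (α, a, y) ∂((refMeasure kind α).prod (refMeasure kind α)) := by
  unfold dataRefMeasure
  rw [lintegral_sum_measure, tsum_fintype, Fintype.sum_prod_type]
  refine Finset.sum_congr rfl fun α _ => Finset.sum_congr rfl fun y _ => ?_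
  have section_measurable : Measurable fun b => F (α, b) := by fun_prop
  rw [lintegral_prod _ hF.aemeasurable, lintegral_dirac,
    lintegral_prod _ section_measurable.aemeasurable]
  simp only [lintegral_dirac]

/-- The exchange of the observed predictor `j` and its knockoff. -/
def swapData (j : Fin p) (e : StudentData I B p) : StudentData I B p :=
  (e.1, swapPair j e.2.1, e.2.2)

theorem measurePreserving_swapPair_refMeasure (α : Finset (Fin p)) (j : Fin p) :
    MeasurePreserving (swapPair j) ((refMeasure kind α).prod (refMeasure kind α))
      ((refMeasure kind α).prod (refMeasure kind α)) := by
  have h := measurePreserving_swapPair j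
    (fun k => if k ∈ α then (kind k).refMeasure else Measure.dirac 0)
    (fun k => if k ∈ α then (kind k).refMeasure else Measure.dirac 0)
  rwa [Function.update_eq_self] at h

@[fun_prop]
theorem measurable_swapData (j : Fin p) :
    Measurable (swapData j : StudentData I B p → StudentData I B p) := by
  unfold swapData
  fun_prop

theorem measurePreserving_swapData (j : Fin p) :
    MeasurePreserving (swapData j) (dataRefMeasure I B kind) (dataRefMeasure I B kind) := by
  refine ⟨measurable_swapData j, Measure.ext_of_lintegral _ fun F hF => ?_⟩
  rw [lintegral_map hF (measurable_swapData j), lintegral_dataRefMeasure (by fun_prop),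
    lintegral_dataRefMeasure hF]
  refine Finset.sum_congr rfl fun α _ => Finset.sum_congr rfl fun y _ => ?_
  exact (measurePreserving_swapPair_refMeasure α j).lintegral_comp
    (f := fun a => F (α, a, y)) (by fun_prop)

/-- The density of the data of a student. -/
def dataDensity (P Q : Params kind) (s : Fin p → ℝ) (q : (Fin p → ℝ) → PMF (Finset (Fin p)))
    (e : StudentData I B p) : ℝ≥0∞ :=
  q e.2.1.1 e.1 * P.obsDensity I e.1 e.2.1.1 e.2.2 *
    Q.knockoffDensity s I e.1 e.2.1.1 e.2.1.2 e.2.2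

theorem measurable_dataDensity (P Q : Params kind) (s : Fin p → ℝ)
    {q : (Fin p → ℝ) → PMF (Finset (Fin p))} (hq : ∀ α, Measurable fun z => q z α) :
    Measurable (dataDensity P Q s q : StudentData I B p → ℝ≥0∞) :=
  measurable_studentData fun α y =>
    (((hq α).comp measurable_fst).mul ((P.measurable_obsDensity α y).comp measurable_fst)).mul
      (Q.measurable_knockoffDensity s α y)

/-! ### Law of the data of a student -/

theorem lintegral_count_withDensity_respProb (t : ℝ) (g : I.Resp B → ℝ≥0∞) :
    ∫⁻ y, g y ∂(Measure.count.withDensity fun y => I.respProb t y) =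
      ∑ y, I.respProb t y * g y := by
  rw [lintegral_withDensity_eq_lintegral_mul _ (measurable_of_countable _)
    (measurable_of_countable _), lintegral_count, tsum_fintype]
  rfl

namespace IsPlugInKnockoffData

variable {Ω : Type*} [MeasurableSpace Ω] {μ : Measure Ω} [IsProbabilityMeasure μ] {N : ℕ}
  {B : Fin N → Finset ι} {P Q : Params kind} {s : Fin p → ℝ}
  {q : Fin N → (Fin p → ℝ) → PMF (Finset (Fin p))} {X : Fin N → Ω → Fin p → ℝ} {Θ : Fin N → Ω → ℝ}
  {Y : (i : Fin N) → Ω → I.Resp (B i)} {A : Fin N → Ω → Finset (Fin p)}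
  {Xs Xt : Fin N → Ω → Fin p → ℝ}

theorem lintegral_predictors_responses
    (hdata : IsPlugInKnockoffData μ I B P Q s q X Θ Y A Xs Xt) (i : Fin N)
    {g : I.Resp (B i) → (Fin p → ℝ) → ℝ≥0∞} (hg : ∀ y, Measurable (g y)) :
    ∫⁻ ω, g (Y i ω) (P.predictors (X i ω)) ∂μ =
      ∑ y, ∫⁻ x, P.latentDensity y x * g y (P.predictors x) := by
  have hX := hdata.measurable_X i
  have hΘ := hdata.measurable_Θ i
  calc ∫⁻ ω, g (Y i ω) (P.predictors (X i ω)) ∂μ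
      = ∫⁻ ω, ∑ y, I.respProb (Θ i ω) y * g y (P.predictors (X i ω)) ∂μ := by
        rw [(hdata.law_Y i).lintegral_eq (g := fun b => g b.2 b.1.1) (hdata.measurable_Y i)
          (by fun_prop) (measurable_from_prod_countable_left fun y => (hg y).comp measurable_fst)]
        simp only [lintegral_count_withDensity_respProb]
    _ = ∫⁻ ω, ∫⁻ t, ∑ y, I.respProb t y * g y (P.predictors (X i ω))
          ∂(gaussianReal (P.abilityMean (P.predictors (X i ω))) P.resVar) ∂μ :=
        (hdata.law_Θ i).lintegral_eq (g := fun b => ∑ y, I.respProb b.2 y * g y b.1) hΘ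
          (by fun_prop) (by fun_prop)
    _ = ∫⁻ ω, ∑ y, P.respDensity I y (P.predictors (X i ω)) * g y (P.predictors (X i ω)) ∂μ := by
        refine lintegral_congr fun ω => ?_
        rw [lintegral_finsetSum _ fun y _ => by fun_prop]
        exact Finset.sum_congr rfl fun y _ => lintegral_mul_const _ (by fun_prop)
    _ = ∫⁻ x, normalDensity P.corr x *
          ∑ y, P.respDensity I y (P.predictors x) * g y (P.predictors x) := by
        rw [← lintegral_map (f := fun x => ∑ y, P.respDensity I y (P.predictors x) *
          g y (P.predictors x)) (by fun_prop) hX, hdata.law_X i]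
        exact lintegral_withDensity_eq_lintegral_mul _ (by fun_prop) (by fun_prop)
    _ = ∑ y, ∫⁻ x, P.latentDensity y x * g y (P.predictors x) := by
        simp only [Finset.mul_sum, ← mul_assoc]
        exact lintegral_finsetSum _ fun y _ => by fun_prop

theorem lintegral_complete_predictors (hdata : IsPlugInKnockoffData μ I B P Q s q X Θ Y A Xs Xt)
    (i : Fin N) (hq : ∀ α, Measurable fun z => q i z α)
    {g : Finset (Fin p) → I.Resp (B i) → (Fin p → ℝ) → ℝ≥0∞} (hg : ∀ α y, Measurable (g α y)) :
    ∫⁻ ω, g (A i ω) (Y i ω) (P.predictors (X i ω)) ∂μ = ∑ α, ∑ y,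
      ∫⁻ x, P.latentDensity y x * (q i (P.predictors x) α * g α y (P.predictors x)) := by
  have hX := hdata.measurable_X i
  have hY := hdata.measurable_Y i
  have term_measurable (α : Finset (Fin p)) (y : I.Resp (B i)) :
      Measurable fun z => q i z α * g α y z := (hq α).mul (hg α y)
  calc ∫⁻ ω, g (A i ω) (Y i ω) (P.predictors (X i ω)) ∂μ
      = ∫⁻ ω, ∑ α, q i (P.predictors (X i ω)) α * g α (Y i ω) (P.predictors (X i ω)) ∂μ := by
        rw [(hdata.law_A i).lintegral_eq (g := fun b => g b.2 b.1.2 b.1.1)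
          (hdata.measurable_A i) (by fun_prop) (measurable_from_prod_countable_left fun α =>
            measurable_from_prod_countable_left fun y => hg α y)]
        simp only [lintegral_fintype, PMF.toMeasure_apply_singleton _ _
          (measurableSet_singleton _), mul_comm]
    _ = ∑ y, ∫⁻ x, P.latentDensity y x *
          ∑ α, q i (P.predictors x) α * g α y (P.predictors x) :=
        hdata.lintegral_predictors_responses i
          (g := fun y z => ∑ α, q i z α * g α y z) (by fun_prop)
    _ = ∑ α, ∑ y, ∫⁻ x, P.latentDensity y x *
          (q i (P.predictors x) α * g α y (P.predictors x)) := by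
        rw [Finset.sum_comm]
        refine Finset.sum_congr rfl fun y _ => ?_
        simp only [Finset.mul_sum]
        exact lintegral_finsetSum _ fun α _ => (P.measurable_latentDensity y).mul
          ((term_measurable α y).comp P.measurable_predictors)

theorem lintegral_observed_predictors (hdata : IsPlugInKnockoffData μ I B P Q s q X Θ Y A Xs Xt)
    (i : Fin N) (hq_meas : ∀ α, Measurable fun z => q i z α) (hq : SMAR P.nonNull (q i))
    {g : Finset (Fin p) → I.Resp (B i) → (Fin p → ℝ) → ℝ≥0∞} (hg : ∀ α y, Measurable (g α y)) :
    ∫⁻ ω, g (A i ω) (Y i ω) (mask (A i ω) (P.predictors (X i ω))) ∂μ = ∑ α, ∑ y,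
      ∫⁻ z, q i z α * P.obsDensity I α z y * g α y z ∂(refMeasure kind α) := by
  rw [hdata.lintegral_complete_predictors i hq_meas (g := fun α y z => g α y (mask α z))
    fun α y => by fun_prop]
  refine Finset.sum_congr rfl fun α _ => Finset.sum_congr rfl fun y _ => ?_
  simp only [← hq.mask_apply α (P.predictors _)]
  have integrand_measurable : Measurable fun x => P.latentDensity y x *
      (q i (mask α (P.predictors x)) α * g α y (mask α (P.predictors x))) :=
    (P.measurable_latentDensity y).mul (((hq_meas α).mul (hg α y)).comp (by fun_prop))
  rw [P.lintegral_mask_predictors α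
    (G := fun z x => P.latentDensity y x * (q i z α * g α y z)) integrand_measurable]
  refine lintegral_congr fun z => ?_
  rw [lintegral_mul_const _ (P.measurable_latentDensity y), P.obsDensity_eq_lintegral]
  ring

theorem lintegral_observed_knockoffs (hdata : IsPlugInKnockoffData μ I B P Q s q X Θ Y A Xs Xt)
    (i : Fin N) {h : StudentData I (B i) p → ℝ≥0∞} (hh : Measurable h) :
    ∫⁻ ω, h (observedData (A i ω) (P.predictors (X i ω)) (Q.predictors (Xt i ω)) (Y i ω)) ∂μ =
      ∫⁻ ω, ∫⁻ zt, h (A i ω, (mask (A i ω) (P.predictors (X i ω)), zt), Y i ω) *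
        Q.knockoffDensity s I (A i ω) (mask (A i ω) (P.predictors (X i ω))) zt (Y i ω)
          ∂(refMeasure kind (A i ω)) ∂μ := by
  have hA := hdata.measurable_A i
  have hX := hdata.measurable_X i
  have hY := hdata.measurable_Y i
  have hXs := hdata.measurable_Xs i
  have knockoff_measurable : Measurable
      fun b : ((Finset (Fin p) × (Fin p → ℝ) × I.Resp (B i)) × (Fin p → ℝ)) × (Fin p → ℝ) =>
        h (b.1.1.1, (b.1.1.2.1, mask b.1.1.1 (Q.predictors b.2)), b.1.1.2.2) := by
    fun_prop
  unfold observedData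
  rw [(hdata.law_Xt i).lintegral_eq (hdata.measurable_Xt i) (by fun_prop) knockoff_measurable,
    (hdata.law_Xs i).lintegral_eq hXs (by fun_prop)
      (Q.measurable_lintegral_knockoffKernel s knockoff_measurable measurable_snd)]
  exact lintegral_congr fun ω => Q.lintegral_latentPosterior_knockoffKernel s (A i ω) _ (Y i ω)
    (g := fun zt => h (A i ω, (mask (A i ω) (P.predictors (X i ω)), zt), Y i ω)) (by fun_prop)

theorem map_observedData (hdata : IsPlugInKnockoffData μ I B P Q s q X Θ Y A Xs Xt) (i : Fin N)
    (hq_meas : ∀ α, Measurable fun z => q i z α) (hq : SMAR P.nonNull (q i)) :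
    μ.map (fun ω =>
        observedData (A i ω) (P.predictors (X i ω)) (Q.predictors (Xt i ω)) (Y i ω)) =
      (dataRefMeasure I (B i) kind).withDensity (dataDensity P Q s (q i)) := by
  have hA := hdata.measurable_A i
  have hX := hdata.measurable_X i
  have hXt := hdata.measurable_Xt i
  have hY := hdata.measurable_Y i
  have density_measurable := measurable_dataDensity (I := I) (B := B i) P Q s hq_meas
  refine Measure.ext_of_lintegral _ fun h hh => ?_
  have integrand_measurable (α : Finset (Fin p)) (y : I.Resp (B i)) :
      Measurable fun a : (Fin p → ℝ) × (Fin p → ℝ) =>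
        h (α, a, y) * Q.knockoffDensity s I α a.1 a.2 y := by
    fun_prop
  rw [lintegral_map hh (by fun_prop), hdata.lintegral_observed_knockoffs i hh,
    hdata.lintegral_observed_predictors i hq_meas hq (g := fun α y z => ∫⁻ zt,
      h (α, (z, zt), y) * Q.knockoffDensity s I α z zt y ∂(refMeasure kind α))
      fun α y => (integrand_measurable α y).lintegral_prod_right',
    lintegral_withDensity_eq_lintegral_mul _ density_measurable hh,
    lintegral_dataRefMeasure (density_measurable.mul hh)]
  refine Finset.sum_congr rfl fun α _ => Finset.sum_congr rfl fun y _ => ?_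
  rw [lintegral_prod _ (by fun_prop)]
  refine lintegral_congr fun z => ?_
  rw [← lintegral_const_mul _ (by fun_prop)]
  refine lintegral_congr fun zt => ?_
  simp only [Pi.mul_apply, dataDensity]
  ring

end IsPlugInKnockoffData

/-! ### Likelihood ratios -/

theorem div_mul_div_mul_cancel_of_ne {a b k a' k' : ℝ≥0∞} (hb : b ≠ 0) (hb' : b ≠ ∞)
    (h : a' * k' ≠ 0) (h' : a' * k' ≠ ∞) :
    a / b * k / (a' / b * k') * (a' * k') = a * k := by
  have div_mul_eq (x w : ℝ≥0∞) : x / b * w = x * w * b⁻¹ := by rw [div_eq_mul_inv]; ring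
  rw [div_mul_eq, div_mul_eq, ENNReal.mul_div_mul_right _ _ (ENNReal.inv_ne_zero.mpr hb')
    (ENNReal.inv_ne_top.mpr hb), ENNReal.div_mul_cancel h h']

theorem values_update {z zt : Fin p → ℝ} (hz : ∀ k, z k ∈ (kind k).values)
    (hzt : ∀ k, zt k ∈ (kind k).values) (j k : Fin p) :
    Function.update z j (zt j) k ∈ (kind k).values := by
  rcases eq_or_ne k j with rfl | h <;> simp [*]

namespace Params

variable (M : Params kind) {s : Fin p → ℝ} {z zt : Fin p → ℝ}

theorem condDensity_ne_zero (α : Finset (Fin p)) (j : Fin p) (hz : ∀ k, z k ∈ (kind k).values)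
    (y : I.Resp B) : M.condDensity I α j z y ≠ 0 :=
  ENNReal.div_ne_zero.mpr ⟨M.obsDensity_ne_zero (fun k _ => hz k) y, M.obsDensity_ne_top _ _ y⟩

theorem condDensity_ne_top (α : Finset (Fin p)) (j : Fin p) (hz : ∀ k, z k ∈ (kind k).values)
    (y : I.Resp B) : M.condDensity I α j z y ≠ ∞ :=
  ENNReal.div_ne_top (M.obsDensity_ne_top _ _ y) (M.obsDensity_ne_zero (fun k _ => hz k) y)

theorem knockoffDensity_ne_zero (hs : (jointCov M.corr s).PosDef) (α : Finset (Fin p))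
    (hz : ∀ k, z k ∈ (kind k).values) (hzt : ∀ k, zt k ∈ (kind k).values) (y : I.Resp B) :
    M.knockoffDensity s I α z zt y ≠ 0 :=
  ENNReal.div_ne_zero.mpr ⟨M.jointDensity_ne_zero hs (fun k _ => hz k) (fun k _ => hzt k) y,
    M.obsDensity_ne_top _ _ y⟩

theorem knockoffDensity_ne_top (hs : (jointCov M.corr s).PosDef) (α : Finset (Fin p))
    (hz : ∀ k, z k ∈ (kind k).values) (zt : Fin p → ℝ) (y : I.Resp B) :
    M.knockoffDensity s I α z zt y ≠ ∞ :=
  ENNReal.div_ne_top (M.jointDensity_ne_top hs α z zt y)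
    (M.obsDensity_ne_zero (fun k _ => hz k) y)

theorem obsDensity_erase_update (α : Finset (Fin p)) (j : Fin p) (z : Fin p → ℝ) (t : ℝ)
    (y : I.Resp B) :
    M.obsDensity I (α.erase j) (Function.update z j t) y = M.obsDensity I (α.erase j) z y :=
  M.obsDensity_congr (fun _ hk => Function.update_of_ne (Finset.ne_of_mem_erase hk) _ _) y

theorem obsDensity_mul_knockoffDensity (α : Finset (Fin p)) (hz : ∀ k, z k ∈ (kind k).values)
    (zt : Fin p → ℝ) (y : I.Resp B) :
    M.obsDensity I α z y * M.knockoffDensity s I α z zt y = M.jointDensity s I α z zt y :=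
  ENNReal.mul_div_cancel (M.obsDensity_ne_zero (fun k _ => hz k) y) (M.obsDensity_ne_top _ _ y)

end Params

section SwapRatio

variable {P Q : Params kind} {s : Fin p → ℝ} {z zt : Fin p → ℝ}

variable (P Q s) in
/-- The likelihood ratio of the data of a student and the data with the observed predictor `j`
and its knockoff exchanged: the argument of the logarithm in `klHat`. -/
def swapRatio (α : Finset (Fin p)) (z zt : Fin p → ℝ) (y : I.Resp B) (j : Fin p) : ℝ≥0∞ :=
  (P.condDensity I α j z y * Q.knockoffDensity s I α z zt y) /
    (P.condDensity I α j (Function.update z j (zt j)) y *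
      Q.knockoffDensity s I α (Function.update z j (zt j)) (Function.update zt j (z j)) y)

theorem swapRatio_ne_zero (hs : (jointCov Q.corr s).PosDef) (α : Finset (Fin p))
    (hz : ∀ k, z k ∈ (kind k).values) (hzt : ∀ k, zt k ∈ (kind k).values) (y : I.Resp B)
    (j : Fin p) : swapRatio P Q s α z zt y j ≠ 0 :=
  have hz' := values_update hz hzt j
  ENNReal.div_ne_zero.mpr
    ⟨mul_ne_zero (P.condDensity_ne_zero α j hz y) (Q.knockoffDensity_ne_zero hs α hz hzt y),
      ENNReal.mul_ne_top (P.condDensity_ne_top α j hz' y) (Q.knockoffDensity_ne_top hs α hz' _ y)⟩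

theorem swapRatio_ne_top (hs : (jointCov Q.corr s).PosDef) (α : Finset (Fin p))
    (hz : ∀ k, z k ∈ (kind k).values) (hzt : ∀ k, zt k ∈ (kind k).values) (y : I.Resp B)
    (j : Fin p) : swapRatio P Q s α z zt y j ≠ ∞ :=
  have hz' := values_update hz hzt j
  have hzt' := values_update hzt hz j
  ENNReal.div_ne_top
    (ENNReal.mul_ne_top (P.condDensity_ne_top α j hz y) (Q.knockoffDensity_ne_top hs α hz _ y))
    (mul_ne_zero (P.condDensity_ne_zero α j hz' y) (Q.knockoffDensity_ne_zero hs α hz' hzt' y))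

theorem ofReal_exp_log_swapRatio (hs : (jointCov Q.corr s).PosDef) (α : Finset (Fin p))
    (hz : ∀ k, z k ∈ (kind k).values) (hzt : ∀ k, zt k ∈ (kind k).values) (y : I.Resp B)
    (j : Fin p) :
    ENNReal.ofReal (Real.exp (Real.log (swapRatio P Q s α z zt y j).toReal)) =
      swapRatio P Q s α z zt y j := by
  have ratio_ne_top := swapRatio_ne_top (P := P) hs α hz hzt y j
  rw [Real.exp_log (ENNReal.toReal_pos (swapRatio_ne_zero hs α hz hzt y j) ratio_ne_top),
    ENNReal.ofReal_toReal ratio_ne_top]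

theorem swapRatio_mul (hs : (jointCov Q.corr s).PosDef) (α : Finset (Fin p))
    (hz : ∀ k, z k ∈ (kind k).values) (hzt : ∀ k, zt k ∈ (kind k).values) (y : I.Resp B)
    (j : Fin p) :
    swapRatio P Q s α z zt y j *
      (P.obsDensity I α (Function.update z j (zt j)) y *
        Q.knockoffDensity s I α (Function.update z j (zt j)) (Function.update zt j (z j)) y) =
      P.obsDensity I α z y * Q.knockoffDensity s I α z zt y := by
  have hz' := values_update hz hzt j
  have hzt' := values_update hzt hz j
  unfold swapRatio Params.condDensity
  rw [P.obsDensity_erase_update]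
  exact div_mul_div_mul_cancel_of_ne (P.obsDensity_ne_zero (fun k _ => hz k) y)
    (P.obsDensity_ne_top _ _ y)
    (mul_ne_zero (P.obsDensity_ne_zero (fun k _ => hz' k) y)
      (Q.knockoffDensity_ne_zero hs α hz' hzt' y))
    (ENNReal.mul_ne_top (P.obsDensity_ne_top _ _ y) (Q.knockoffDensity_ne_top hs α hz' _ y))

theorem swapRatio_self (hs : (jointCov P.corr s).PosDef) {j : Fin p} (hj : j ∉ P.nonNull)
    (α : Finset (Fin p)) (hz : ∀ k, z k ∈ (kind k).values) (hzt : ∀ k, zt k ∈ (kind k).values)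
    (y : I.Resp B) : swapRatio P P s α z zt y j = 1 := by
  have ratio_mul := swapRatio_mul (P := P) hs α hz hzt y j
  have exchangeable : P.jointDensity s I α (Function.update z j (zt j))
      (Function.update zt j (z j)) y = P.jointDensity s I α z zt y :=
    P.jointDensity_swapPair hj s α (z, zt) y
  rw [P.obsDensity_mul_knockoffDensity α hz,
    P.obsDensity_mul_knockoffDensity α (values_update hz hzt j), exchangeable] at ratio_mul
  exact (ENNReal.mul_left_inj
    (P.jointDensity_ne_zero hs (fun k _ => hz k) (fun k _ => hzt k) y)
    (P.jointDensity_ne_top hs α z zt y)).mp (ratio_mul.trans (one_mul _).symm)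

variable {q : (Fin p → ℝ) → PMF (Finset (Fin p))}

theorem dataDensity_observedData (hq : SMAR P.nonNull q) (α : Finset (Fin p))
    (z zt : Fin p → ℝ) (y : I.Resp B) :
    dataDensity P Q s q (observedData α z zt y) =
      q z α * P.obsDensity I α z y * Q.knockoffDensity s I α z zt y := by
  have mask_eq (z : Fin p → ℝ) : ∀ k ∈ α, mask α z k = z k := fun k hk => by simp [mask, hk]
  simp only [dataDensity, observedData, Params.knockoffDensity]
  rw [hq.mask_apply, P.obsDensity_congr (mask_eq z), Q.obsDensity_congr (mask_eq z),
    Q.jointDensity_congr s (mask_eq z) (mask_eq zt)]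

theorem swapData_observedData_of_notMem {α : Finset (Fin p)} {j : Fin p} (hj : j ∉ α)
    (z zt : Fin p → ℝ) (y : I.Resp B) :
    swapData j (observedData α z zt y) = observedData α z zt y := by
  have masked (z : Fin p → ℝ) : mask α z j = 0 := by simp [mask, hj]
  have update_mask (z zt : Fin p → ℝ) : Function.update (mask α z) j (mask α zt j) = mask α z := by
    rw [masked zt, ← masked z, Function.update_eq_self]
  simp only [swapData, swapPair, observedData, update_mask]

theorem swapData_observedData_of_mem {α : Finset (Fin p)} {j : Fin p} (hj : j ∈ α)
    (z zt : Fin p → ℝ) (y : I.Resp B) :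
    swapData j (observedData α z zt y) =
      observedData α (Function.update z j (zt j)) (Function.update zt j (z j)) y := by
  have update_mask (z zt : Fin p → ℝ) :
      Function.update (mask α z) j (mask α zt j) = mask α (Function.update z j (zt j)) := by
    funext k
    rcases eq_or_ne k j with rfl | hk <;> simp [mask, *]
  simp only [swapData, swapPair, observedData, update_mask]

theorem dataDensity_eq_swapRatio_mul (hs : (jointCov Q.corr s).PosDef)
    (hq : SMAR P.nonNull q) {α : Finset (Fin p)} {j : Fin p} (hjα : j ∈ α)
    (hj : j ∉ P.nonNull) (hz : ∀ k, z k ∈ (kind k).values) (hzt : ∀ k, zt k ∈ (kind k).values)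
    (y : I.Resp B) :
    dataDensity P Q s q (observedData α z zt y) =
      swapRatio P Q s α z zt y j *
        dataDensity P Q s q (swapData j (observedData α z zt y)) := by
  have missingness_invariant : q (Function.update z j (zt j)) α = q z α :=
    hq α _ _ fun k _ hk => Function.update_of_ne (ne_of_mem_of_not_mem hk hj) _ _
  rw [swapData_observedData_of_mem hjα, dataDensity_observedData hq, dataDensity_observedData hq,
    missingness_invariant, mul_assoc, ← swapRatio_mul hs α hz hzt y j]
  ring

end SwapRatio

section KLHat

variable {N : ℕ} {B : Fin N → Finset ι} {P Q : Params kind} {s : Fin p → ℝ}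
  {A : Fin N → Finset (Fin p)} {z zt : Fin N → Fin p → ℝ} {j : Fin p}

theorem klHat_eq_sum_log_swapRatio (y : (i : Fin N) → I.Resp (B i)) :
    klHat P Q s I B A z zt y j = ∑ i ∈ Finset.univ.filter fun i => j ∈ A i,
      Real.log (swapRatio P Q s (A i) (z i) (zt i) (y i) j).toReal := rfl

theorem ofReal_exp_klHat (hs : (jointCov Q.corr s).PosDef)
    (hz : ∀ i k, z i k ∈ (kind k).values) (hzt : ∀ i k, zt i k ∈ (kind k).values)
    (y : (i : Fin N) → I.Resp (B i)) :
    ENNReal.ofReal (Real.exp (klHat P Q s I B A z zt y j)) =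
      ∏ i, if j ∈ A i then swapRatio P Q s (A i) (z i) (zt i) (y i) j else 1 := by
  rw [← Finset.prod_filter, klHat_eq_sum_log_swapRatio, Real.exp_sum,
    ENNReal.ofReal_prod_of_nonneg fun i _ => (Real.exp_pos _).le]
  exact Finset.prod_congr rfl fun i _ => ofReal_exp_log_swapRatio hs (A i) (hz i) (hzt i) (y i) j

theorem klHat_self (hs : (jointCov P.corr s).PosDef) (hj : j ∉ P.nonNull)
    (hz : ∀ i k, z i k ∈ (kind k).values) (hzt : ∀ i k, zt i k ∈ (kind k).values)
    (y : (i : Fin N) → I.Resp (B i)) : klHat P P s I B A z zt y j = 0 := by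
  rw [klHat_eq_sum_log_swapRatio]
  refine Finset.sum_eq_zero fun i _ => ?_
  rw [swapRatio_self hs hj (A i) (hz i) (hzt i), ENNReal.toReal_one, Real.log_one]

end KLHat

end Model

/-! ### The threshold -/

section Threshold

variable {p : ℕ} {ν : ℕ}

theorem threshold_lt_iff (hν : 1 ≤ ν) (W : Fin p → ℝ) (c : ℝ) :
    threshold ν W < c ↔
      ∃ t : ℝ, (0 < t ∧ 1 + (Finset.univ.filter fun j => W j < -t).card ≤ ν) ∧ t < c := by
  refine csInf_lt_iff ⟨0, fun t ht => ht.1.le⟩ ?_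
  obtain ⟨m, hm⟩ := (Set.finite_range fun j => |W j|).bddAbove
  refine ⟨max m 0 + 1, by positivity, ?_⟩
  rw [Finset.card_eq_zero.mpr]
  · simpa only [add_zero] using hν
  · refine Finset.filter_eq_empty_iff.mpr fun j _ => not_lt.mpr ?_
    linarith [hm ⟨j, rfl⟩, neg_abs_le (W j), le_max_left m 0]

theorem threshold_nonneg (W : Fin p → ℝ) : 0 ≤ threshold ν W :=
  Real.sInf_nonneg fun _ ht => ht.1.le

theorem measurable_threshold (hν : 1 ≤ ν) : Measurable (threshold ν : (Fin p → ℝ) → ℝ) := by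
  refine measurable_of_Iio fun c => ?_
  have lt_iff_rat : threshold ν ⁻¹' Set.Iio c = ⋃ r : ℚ, {W : Fin p → ℝ | (0 : ℝ) < r ∧
      1 + ∑ j, (if W j < -(r : ℝ) then 1 else 0) ≤ ν ∧ (r : ℝ) < c} := by
    ext W
    simp only [Set.mem_preimage, Set.mem_Iio, Set.mem_ofPred_eq, Set.mem_iUnion,
      threshold_lt_iff hν, ← Finset.card_filter]
    constructor
    · rintro ⟨t, ⟨ht, htν⟩, htc⟩
      obtain ⟨r, htr, hrc⟩ := exists_rat_btwn htc
      refine ⟨r, ht.trans htr, le_trans (Nat.add_le_add_left (Finset.card_le_card ?_) 1) htν, hrc⟩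
      refine Finset.monotone_filter_right _ fun j _ (hj : W j < -(r : ℝ)) => ?_
      linarith
    · rintro ⟨r, hr, hrν, hrc⟩
      exact ⟨r, ⟨hr, hrν⟩, hrc⟩
  rw [lt_iff_rat]
  refine MeasurableSet.iUnion fun r => ?_
  have count_measurable :
      Measurable fun W : Fin p → ℝ => 1 + ∑ j, (if W j < -(r : ℝ) then 1 else 0 : ℕ) :=
    (Finset.measurable_sum _ fun j _ => Measurable.ite
      (measurableSet_lt (measurable_pi_apply j) measurable_const)
      measurable_const measurable_const).const_add 1
  exact (MeasurableSet.const _).inter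
    ((measurableSet_le count_measurable measurable_const).inter (MeasurableSet.const _))

theorem measurableSet_mem_selected (hν : 1 ≤ ν) (j : Fin p) :
    MeasurableSet {W : Fin p → ℝ | j ∈ selected ν W} :=
  measurableSet_lt (measurable_threshold hν) (measurable_pi_apply j)

/-- The magnitude of the statistic `W j` exceeds the threshold computed with `|W j|` in place
of `W j`.  Unlike `j ∈ selected ν W`, this does not depend on the sign of `W j`. -/
def ExceedsThreshold (ν : ℕ) (W : Fin p → ℝ) (j : Fin p) : Prop :=
  threshold ν (Function.update W j |W j|) < |W j|

theorem pos_and_exceedsThreshold_of_mem_selected {W : Fin p → ℝ} {j : Fin p}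
    (h : j ∈ selected ν W) :
    0 < W j ∧ ExceedsThreshold ν W j := by
  have pos : 0 < W j := (threshold_nonneg W).trans_lt h
  refine ⟨pos, ?_⟩
  rwa [ExceedsThreshold, abs_of_pos pos, Function.update_eq_self]

theorem exceedsThreshold_congr {W W' : Fin p → ℝ} {j : Fin p} (hj : |W' j| = |W j|)
    (h : ∀ k, k ≠ j → W' k = W k) : ExceedsThreshold ν W' j ↔ ExceedsThreshold ν W j := by
  have update_eq : Function.update W' j |W j| = Function.update W j |W j| := by
    funext k
    rcases eq_or_ne k j with rfl | hk <;> simp [*]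
  rw [ExceedsThreshold, ExceedsThreshold, hj, update_eq]

variable (ν) in
/-- The statistics for which `W j` is negative, with a magnitude that leads to the selection of `j`
when the sign of `W j` is changed. -/
def missedSet (j : Fin p) : Set (Fin p → ℝ) := {W | W j < 0 ∧ ExceedsThreshold ν W j}

theorem mem_missedSet_of_mem_selected {W W' : Fin p → ℝ} {j : Fin p} (hj : j ∈ selected ν W)
    (h : ∀ k, W' k = if k = j then -W k else W k) : W' ∈ missedSet ν j := by
  obtain ⟨pos, exceeds⟩ := pos_and_exceedsThreshold_of_mem_selected hj
  have neg_eq : W' j = -W j := by rw [h, if_pos rfl]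
  refine ⟨by linarith, (exceedsThreshold_congr ?_ fun k hk => ?_).mpr exceeds⟩
  · rw [neg_eq, abs_neg]
  · rw [h, if_neg hk]

open Classical in
theorem card_missedSet_le (hν : 1 ≤ ν) (W : Fin p → ℝ) :
    (Finset.univ.filter fun j => W ∈ missedSet ν j).card ≤ ν := by
  set J := Finset.univ.filter fun j => W ∈ missedSet ν j
  rcases J.eq_empty_or_nonempty with hJ | hJ
  · simp [hJ]
  -- All of `J` except the element with the largest `W j` is counted at the threshold for `|W j|`.
  obtain ⟨j, hj, hmax⟩ := J.exists_max_image W hJ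
  obtain ⟨neg, exceeds⟩ := (Finset.mem_filter.mp hj).2
  obtain ⟨t, ⟨_, htν⟩, htj⟩ := (threshold_lt_iff hν _ _).mp exceeds
  rw [abs_of_neg neg] at htν htj
  have erase_subset : J.erase j ⊆
      Finset.univ.filter fun k => Function.update W j (-W j) k < -t := fun k hk => by
    obtain ⟨hkj, hkJ⟩ := Finset.mem_erase.mp hk
    rw [Finset.mem_filter, Function.update_of_ne hkj]
    exact ⟨Finset.mem_univ _, by linarith [hmax k hkJ]⟩
  have card_le := Finset.card_le_card erase_subset
  have card_erase := Finset.card_erase_add_one hj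
  omega

theorem measurableSet_missedSet (hν : 1 ≤ ν) (j : Fin p) : MeasurableSet (missedSet ν j) := by
  have abs_measurable : Measurable fun W : Fin p → ℝ => |W j| := (measurable_pi_apply j).abs
  have update_measurable : Measurable fun W : Fin p → ℝ => Function.update W j |W j| :=
    measurable_pi_lambda _ fun k => by
      rcases eq_or_ne k j with rfl | hk
      · simpa only [Function.update_self] using abs_measurable
      · simpa only [Function.update_of_ne hk] using measurable_pi_apply k
  exact (measurableSet_lt (measurable_pi_apply j) measurable_const).inter
    (measurableSet_lt ((measurable_threshold hν).comp update_measurable) abs_measurable)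

theorem sum_measure_missedSet_le (hν : 1 ≤ ν) {E : Type*} [MeasurableSpace E] (m : Measure E)
    {V : E → Fin p → ℝ} (hV : Measurable V) :
    ∑ j, m (V ⁻¹' missedSet ν j) ≤ ν * m Set.univ := by
  classical
  have missed_measurable (j : Fin p) : MeasurableSet (V ⁻¹' missedSet ν j) :=
    hV (measurableSet_missedSet hν j)
  calc ∑ j, m (V ⁻¹' missedSet ν j)
      = ∫⁻ e, ∑ j, (V ⁻¹' missedSet ν j).indicator 1 e ∂m := by
        rw [lintegral_finsetSum _ fun j _ => measurable_one.indicator (missed_measurable j)]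
        simp_rw [lintegral_indicator_one (missed_measurable _)]
    _ ≤ ∫⁻ _, ν ∂m := by
        refine lintegral_mono fun e => le_trans (le_of_eq ?_)
          (Nat.cast_le.mpr (card_missedSet_le hν (V e)))
        rw [Finset.natCast_card_filter]
        simp only [Set.indicator_apply, Set.mem_preimage, Pi.one_apply]
    _ = ν * m Set.univ := lintegral_const _

theorem lintegral_sum_selected_ratio_le (hν : 1 ≤ ν) {E : Type*} [MeasurableSpace E]
    {m : Measure E} {f : E → ℝ≥0∞} (hf : Measurable f) {σ : Fin p → E → E}
    (hσ : ∀ j, MeasurePreserving (σ j) m m) {V : E → Fin p → ℝ} (hV : Measurable V)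
    (hVσ : ∀ j e k, V (σ j e) k = if k = j then -V e k else V e k) :
    ∫⁻ e, ∑ j, (selected ν (V e)).indicator (fun j => f (σ j e) / f e) j ∂(m.withDensity f) ≤
      ν * m.withDensity f Set.univ := by
  have missed_measurable (j : Fin p) : MeasurableSet (V ⁻¹' missedSet ν j) :=
    hV (measurableSet_missedSet hν j)
  have pointwise (e : E) (j : Fin p) :
      f e * (selected ν (V e)).indicator (fun j => f (σ j e) / f e) j ≤
        (V ⁻¹' missedSet ν j).indicator f (σ j e) := by
    by_cases hj : j ∈ selected ν (V e)
    · have missed : σ j e ∈ V ⁻¹' missedSet ν j := mem_missedSet_of_mem_selected hj (hVσ j e)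
      rw [Set.indicator_of_mem hj, Set.indicator_of_mem missed]
      exact ENNReal.mul_div_le
    · rw [Set.indicator_of_notMem hj, mul_zero]
      exact zero_le
  calc ∫⁻ e, ∑ j, (selected ν (V e)).indicator (fun j => f (σ j e) / f e) j ∂(m.withDensity f)
      ≤ ∫⁻ e, f e * ∑ j, (selected ν (V e)).indicator (fun j => f (σ j e) / f e) j ∂m :=
        lintegral_withDensity_le_lintegral_mul _ hf _
    _ ≤ ∫⁻ e, ∑ j, (V ⁻¹' missedSet ν j).indicator f (σ j e) ∂m := by
        simp_rw [Finset.mul_sum]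
        exact lintegral_mono fun e => Finset.sum_le_sum fun j _ => pointwise e j
    _ = ∑ j, ∫⁻ e, (V ⁻¹' missedSet ν j).indicator f (σ j e) ∂m :=
        lintegral_finsetSum _ fun j _ =>
          (hf.indicator (missed_measurable j)).comp (hσ j).measurable
    _ = ∑ j, m.withDensity f (V ⁻¹' missedSet ν j) := by
        refine Finset.sum_congr rfl fun j _ => ?_
        rw [(hσ j).lintegral_comp (hf.indicator (missed_measurable j)),
          lintegral_indicator (missed_measurable j), withDensity_apply _ (missed_measurable j)]
    _ ≤ ν * m.withDensity f Set.univ := sum_measure_missedSet_le hν _ hV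

end Threshold

/-! ### The sample of all students -/

section Sample

variable {p N : ℕ} {kind : Fin p → PredictorKind} {ι : Type*} {I : Items ι} {B : Fin N → Finset ι}

variable (I B) in
/-- The data of all students. -/
abbrev SampleData (p : ℕ) : Type _ := (i : Fin N) → StudentData I (B i) p

/-- The exchange of the observed predictor `j` and its knockoff for all students. -/
def swapSample (j : Fin p) (d : SampleData I B p) : SampleData I B p := fun i => swapData j (d i)

variable (I B) in
/-- The measure with respect to which the data of all students have a density. -/
def sampleRefMeasure (kind : Fin p → PredictorKind) : Measure (SampleData I B p) :=
  Measure.pi fun i => dataRefMeasure I (B i) kind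

theorem measurePreserving_swapSample (j : Fin p) :
    MeasurePreserving (swapSample j) (sampleRefMeasure I B kind) (sampleRefMeasure I B kind) :=
  measurePreserving_pi _ _ fun _ => measurePreserving_swapData j

/-- The density of the data of all students. -/
def sampleDensity (P Q : Params kind) (s : Fin p → ℝ)
    (q : Fin N → (Fin p → ℝ) → PMF (Finset (Fin p))) (d : SampleData I B p) : ℝ≥0∞ :=
  ∏ i, dataDensity P Q s (q i) (d i)

theorem measurable_sampleDensity (P Q : Params kind) (s : Fin p → ℝ)
    {q : Fin N → (Fin p → ℝ) → PMF (Finset (Fin p))} (hq : ∀ i α, Measurable fun z => q i z α) :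
    Measurable (sampleDensity P Q s q : SampleData I B p → ℝ≥0∞) :=
  Finset.measurable_prod _ fun i _ =>
    (measurable_dataDensity P Q s (hq i)).comp (measurable_pi_apply i)

/-- The data of all students, with the unobserved entries masked. -/
def sample (A : Fin N → Finset (Fin p)) (z zt : Fin N → Fin p → ℝ)
    (y : (i : Fin N) → I.Resp (B i)) : SampleData I B p :=
  fun i => observedData (A i) (z i) (zt i) (y i)

theorem sampleDensity_sample_eq_exp_klHat_mul {P Q : Params kind} {s : Fin p → ℝ}
    {q : Fin N → (Fin p → ℝ) → PMF (Finset (Fin p))} (hs : (jointCov Q.corr s).PosDef)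
    (hq : ∀ i, SMAR P.nonNull (q i)) {j : Fin p} (hj : j ∉ P.nonNull)
    (A : Fin N → Finset (Fin p)) {z zt : Fin N → Fin p → ℝ}
    (hz : ∀ i k, z i k ∈ (kind k).values) (hzt : ∀ i k, zt i k ∈ (kind k).values)
    (y : (i : Fin N) → I.Resp (B i)) :
    sampleDensity P Q s q (sample A z zt y) =
      ENNReal.ofReal (Real.exp (klHat P Q s I B A z zt y j)) *
        sampleDensity P Q s q (swapSample j (sample A z zt y)) := by
  simp only [sampleDensity, swapSample, sample]
  rw [ofReal_exp_klHat hs hz hzt, ← Finset.prod_mul_distrib]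
  refine Finset.prod_congr rfl fun i _ => ?_
  split_ifs with hi
  · exact dataDensity_eq_swapRatio_mul hs (hq i) hi hj (hz i) (hzt i) (y i)
  · rw [one_mul, swapData_observedData_of_notMem hi]

section Law

variable {Ω : Type*} [MeasurableSpace Ω] {μ : Measure Ω} [IsProbabilityMeasure μ]
  {P Q : Params kind} {s : Fin p → ℝ}
  {q : Fin N → (Fin p → ℝ) → PMF (Finset (Fin p))} {X : Fin N → Ω → Fin p → ℝ}
  {Θ : Fin N → Ω → ℝ} {Y : (i : Fin N) → Ω → I.Resp (B i)} {A : Fin N → Ω → Finset (Fin p)}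
  {Xs Xt : Fin N → Ω → Fin p → ℝ}

theorem IsPlugInKnockoffData.measurable_observedData
    (hdata : IsPlugInKnockoffData μ I B P Q s q X Θ Y A Xs Xt) (i : Fin N) :
    Measurable fun ω =>
      observedData (A i ω) (P.predictors (X i ω)) (Q.predictors (Xt i ω)) (Y i ω) := by
  have := hdata.measurable_A i
  have := hdata.measurable_X i
  have := hdata.measurable_Xt i
  have := hdata.measurable_Y i
  fun_prop

theorem IsPlugInKnockoffData.iIndepFun_observedData
    (hdata : IsPlugInKnockoffData μ I B P Q s q X Θ Y A Xs Xt) :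
    iIndepFun (fun i ω =>
      observedData (A i ω) (P.predictors (X i ω)) (Q.predictors (Xt i ω)) (Y i ω)) μ := by
  let student (i : Fin N) (a : (Fin p → ℝ) × ℝ × I.Resp (B i) × Finset (Fin p) × (Fin p → ℝ) ×
      (Fin p → ℝ)) : StudentData I (B i) p :=
    observedData a.2.2.2.1 (P.predictors a.1) (Q.predictors a.2.2.2.2.2) a.2.2.1
  have student_measurable (i : Fin N) : Measurable (student i) := by fun_prop
  exact hdata.indep.comp student student_measurable

theorem IsPlugInKnockoffData.measurePreserving_sample
    (hdata : IsPlugInKnockoffData μ I B P Q s q X Θ Y A Xs Xt)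
    (hq_meas : ∀ i α, Measurable fun z => q i z α) (hq : ∀ i, SMAR P.nonNull (q i)) :
    MeasurePreserving
      (fun ω => sample (A · ω) (fun i => P.predictors (X i ω)) (fun i => Q.predictors (Xt i ω))
        (Y · ω))
      μ ((sampleRefMeasure I B kind).withDensity (sampleDensity P Q s q)) := by
  have student_law (i : Fin N) := hdata.map_observedData i (hq_meas i) (hq i)
  have (i : Fin N) : IsProbabilityMeasure
      ((dataRefMeasure I (B i) kind).withDensity (dataDensity P Q s (q i))) := by
    rw [← student_law i]
    exact Measure.isProbabilityMeasure_map (hdata.measurable_observedData i).aemeasurable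
  refine ⟨measurable_pi_lambda _ hdata.measurable_observedData, ?_⟩
  unfold sample
  rw [(iIndepFun_iff_map_fun_eq_pi_map fun i =>
    (hdata.measurable_observedData i).aemeasurable).mp hdata.iIndepFun_observedData]
  simp_rw [student_law]
  exact pi_withDensity _ fun i => measurable_dataDensity P Q s (hq_meas i)

end Law

variable {w : Fin p → (Fin N → Finset (Fin p)) → (Fin N → Fin p → ℝ) → (Fin N → Fin p → ℝ) →
      ((i : Fin N) → I.Resp (B i)) → ℝ}

/-- The statistics `w` as functions of the data of all students. -/
def dataStatistics (w : Fin p → (Fin N → Finset (Fin p)) → (Fin N → Fin p → ℝ) →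
    (Fin N → Fin p → ℝ) → ((i : Fin N) → I.Resp (B i)) → ℝ) (d : SampleData I B p) (j : Fin p) :
    ℝ :=
  w j (fun i => (d i).1) (fun i => mask (d i).1 (d i).2.1.1) (fun i => mask (d i).1 (d i).2.1.2)
    fun i => (d i).2.2

theorem dataStatistics_sample (A : Fin N → Finset (Fin p)) (z zt : Fin N → Fin p → ℝ)
    (y : (i : Fin N) → I.Resp (B i)) (j : Fin p) :
    dataStatistics w (sample A z zt y) j =
      w j A (fun i => mask (A i) (z i)) (fun i => mask (A i) (zt i)) y := by
  simp only [dataStatistics, sample, observedData, mask_mask]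

theorem measurable_dataStatistics (hw : ∀ j A y, Measurable
    fun d : (Fin N → Fin p → ℝ) × (Fin N → Fin p → ℝ) => w j A d.1 d.2 y) :
    Measurable (dataStatistics w) := by
  refine measurable_pi_lambda _ fun j => ?_
  have uncurried_measurable :
      Measurable fun b : ((Fin N → Finset (Fin p)) × ((i : Fin N) → I.Resp (B i))) ×
        ((Fin N → Fin p → ℝ) × (Fin N → Fin p → ℝ)) => w j b.1.1 b.2.1 b.2.2 b.1.2 :=
    measurable_from_prod_countable_right fun c => hw j c.1 c.2
  exact uncurried_measurable.comp (g := _) (f := fun d : SampleData I B p =>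
    ((fun i => (d i).1, fun i => (d i).2.2),
      (fun i => mask (d i).1 (d i).2.1.1, fun i => mask (d i).1 (d i).2.1.2))) (by fun_prop)

theorem dataStatistics_swapSample (hw : IsKnockoffStatistic w) (j : Fin p)
    (d : SampleData I B p) (k : Fin p) :
    dataStatistics w (swapSample j d) k =
      if k = j then -dataStatistics w d k else dataStatistics w d k := by
  have swapCols_singleton (z zt : Fin N → Fin p → ℝ) (i : Fin N) :
      swapCols (({j} : Finset (Fin p)) : Set (Fin p)) z zt i =
        Function.update (z i) j (zt i j) := by
    funext l
    rcases eq_or_ne l j with rfl | hl <;> simp [swapCols, *]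
  have flip_sign := hw k {j} (fun i => (d i).1) (fun i => (d i).2.1.1) (fun i => (d i).2.1.2)
    fun i => (d i).2.2
  simp_rw [Finset.mem_singleton, swapCols_singleton] at flip_sign
  exact flip_sign

end Sample

/-! ### Selection of null predictors -/

theorem ofReal_exp_neg_eq_div {a b : ℝ≥0∞} {x : ℝ} (h : a = ENNReal.ofReal (Real.exp x) * b)
    (ha : a ≠ 0) (ha' : a ≠ ∞) : ENNReal.ofReal (Real.exp (-x)) = b / a := by
  rw [ENNReal.eq_div_iff ha ha', h, mul_right_comm, ← ENNReal.ofReal_mul (Real.exp_pos x).le,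
    ← Real.exp_add, add_neg_cancel, Real.exp_zero, ENNReal.ofReal_one, one_mul]

theorem ae_withDensity_ne_zero_and_ne_top {E : Type*} [MeasurableSpace E] {m : Measure E}
    {f : E → ℝ≥0∞} (hf : Measurable f) [IsFiniteMeasure (m.withDensity f)] :
    ∀ᵐ e ∂(m.withDensity f), f e ≠ 0 ∧ f e ≠ ∞ := by
  have lintegral_finite : ∫⁻ e, f e ∂m ≠ ∞ := by
    rw [← setLIntegral_univ, ← withDensity_apply _ MeasurableSet.univ]
    exact measure_ne_top _ _
  rw [ae_withDensity_iff hf]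
  filter_upwards [ae_lt_top hf lintegral_finite] with e he h0
  exact ⟨h0, he.ne⟩

theorem lintegral_sum_exp_neg_le {Ω E : Type*} [MeasurableSpace Ω] [MeasurableSpace E]
    {μ : Measure Ω} [IsProbabilityMeasure μ] {m : Measure E} {f : E → ℝ≥0∞} {D : Ω → E} {p ν : ℕ}
    (hf : Measurable f) (hD : MeasurePreserving D μ (m.withDensity f)) (hν : 1 ≤ ν)
    {σ : Fin p → E → E} (hσ : ∀ j, MeasurePreserving (σ j) m m) {V : E → Fin p → ℝ}
    (hV : Measurable V) (hVσ : ∀ j e k, V (σ j e) k = if k = j then -V e k else V e k)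
    {T : Set (Fin p)} {K : Ω → Fin p → ℝ}
    (hK : ∀ ω, ∀ j ∉ T, f (D ω) = ENNReal.ofReal (Real.exp (K ω j)) * f (σ j (D ω))) :
    ∫⁻ ω, ∑ j, (selected ν (V (D ω)) \ T).indicator
        (fun j => ENNReal.ofReal (Real.exp (-K ω j))) j ∂μ ≤ ENNReal.ofReal ν := by
  have : IsProbabilityMeasure (m.withDensity f) := by
    rw [← hD.map_eq]
    exact Measure.isProbabilityMeasure_map hD.aemeasurable
  let ratioSum (e : E) : ℝ≥0∞ := ∑ j, (selected ν (V e)).indicator (fun j => f (σ j e) / f e) j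
  have ratioSum_measurable : Measurable ratioSum := Finset.measurable_sum _ fun j _ =>
    ((hf.comp (hσ j).measurable).div hf).indicator (hV (measurableSet_mem_selected hν j))
  have le_ratioSum : ∀ᵐ ω ∂μ, ∑ j, (selected ν (V (D ω)) \ T).indicator
      (fun j => ENNReal.ofReal (Real.exp (-K ω j))) j ≤ ratioSum (D ω) := by
    filter_upwards [hD.quasiMeasurePreserving.ae (ae_withDensity_ne_zero_and_ne_top hf)]
      with ω ⟨f_ne_zero, f_ne_top⟩
    refine Finset.sum_le_sum fun j _ => Set.indicator_le (fun j hj => ?_) j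
    rw [Set.indicator_of_mem hj.1, ofReal_exp_neg_eq_div (hK ω j hj.2) f_ne_zero f_ne_top]
  calc _ ≤ ∫⁻ ω, ratioSum (D ω) ∂μ := lintegral_mono_ae le_ratioSum
    _ = ∫⁻ e, ratioSum e ∂(m.withDensity f) := hD.lintegral_comp ratioSum_measurable
    _ ≤ ν * m.withDensity f Set.univ := lintegral_sum_selected_ratio_le hν hf hσ hV hVσ
    _ = ENNReal.ofReal ν := by rw [measure_univ, mul_one, ENNReal.ofReal_natCast]

theorem ncard_le_exp_mul_sum_indicator {p : ℕ} (S : Set (Fin p)) (K : Fin p → ℝ) (ε : ℝ) :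
    ({j | j ∈ S ∧ K j ≤ ε}.ncard : ℝ≥0∞) ≤ ENNReal.ofReal (Real.exp ε) *
      ∑ j, S.indicator (fun j => ENNReal.ofReal (Real.exp (-K j))) j := by
  classical
  have one_le (j : Fin p) (hj : K j ≤ ε) :
      1 ≤ ENNReal.ofReal (Real.exp ε) * ENNReal.ofReal (Real.exp (-K j)) := by
    rw [← ENNReal.ofReal_mul (Real.exp_pos ε).le, ← Real.exp_add]
    exact ENNReal.one_le_ofReal.mpr (Real.one_le_exp (by linarith))
  rw [Set.ncard_eq_toFinset_card', Finset.mul_sum, Set.toFinset_ofPred,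
    Finset.natCast_card_filter]
  refine Finset.sum_le_sum fun j _ => ?_
  split_ifs with hj
  · rw [Set.indicator_of_mem hj.1]
    exact one_le j hj.2
  · exact zero_le

theorem lintegral_ncard_le_of_lintegral_exp_neg_le {Ω : Type*} [MeasurableSpace Ω]
    {μ : Measure Ω} {p : ℕ} {S : Ω → Set (Fin p)} {K : Ω → Fin p → ℝ} {c : ℝ}
    (h : ∫⁻ ω, ∑ j, (S ω).indicator (fun j => ENNReal.ofReal (Real.exp (-K ω j))) j ∂μ ≤
      ENNReal.ofReal c) (ε : ℝ) :
    ∫⁻ ω, ({j | j ∈ S ω ∧ K ω j ≤ ε}.ncard : ℝ≥0∞) ∂μ ≤ ENNReal.ofReal (c * Real.exp ε) :=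
  calc ∫⁻ ω, ({j | j ∈ S ω ∧ K ω j ≤ ε}.ncard : ℝ≥0∞) ∂μ
      ≤ ∫⁻ ω, ENNReal.ofReal (Real.exp ε) *
          ∑ j, (S ω).indicator (fun j => ENNReal.ofReal (Real.exp (-K ω j))) j ∂μ :=
        lintegral_mono fun ω => ncard_le_exp_mul_sum_indicator (S ω) (K ω) ε
    _ = ENNReal.ofReal (Real.exp ε) *
          ∫⁻ ω, ∑ j, (S ω).indicator (fun j => ENNReal.ofReal (Real.exp (-K ω j))) j ∂μ :=
        lintegral_const_mul' _ _ ENNReal.ofReal_ne_top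
    _ ≤ ENNReal.ofReal (Real.exp ε) * ENNReal.ofReal c := by gcongr
    _ = ENNReal.ofReal (c * Real.exp ε) := by
        rw [← ENNReal.ofReal_mul (Real.exp_pos ε).le, mul_comm]

end KnockoffIRT

end

theorem theorem1 {Ω : Type*} [MeasurableSpace Ω] (μ : Measure Ω) [IsProbabilityMeasure μ]
    {p N : ℕ} {kind : Fin p → KnockoffIRT.PredictorKind} {ι : Type*}
    (I : KnockoffIRT.Items ι) (B : Fin N → Finset ι)
    (P Q : KnockoffIRT.Params kind)
    (s : Fin p → ℝ) (hs : (KnockoffIRT.jointCov Q.corr s).PosDef)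
    (q : Fin N → (Fin p → ℝ) → PMF (Finset (Fin p)))
    (hq_meas : ∀ i α, Measurable fun z => q i z α)
    (hq : ∀ i, KnockoffIRT.SMAR P.nonNull (q i))
    (X : Fin N → Ω → Fin p → ℝ) (Θ : Fin N → Ω → ℝ)
    (Y : (i : Fin N) → Ω → I.Resp (B i)) (A : Fin N → Ω → Finset (Fin p))
    (Xs Xt : Fin N → Ω → Fin p → ℝ)
    (hdata : KnockoffIRT.IsPlugInKnockoffData μ I B P Q s q X Θ Y A Xs Xt)
    (Z Zt : Fin N → Ω → Fin p → ℝ)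
    (hZ : ∀ i ω, Z i ω = P.predictors (X i ω))
    (hZt : ∀ i ω, Zt i ω = Q.predictors (Xt i ω))
    (w : Fin p → (Fin N → Finset (Fin p)) → (Fin N → Fin p → ℝ) → (Fin N → Fin p → ℝ) →
      ((i : Fin N) → I.Resp (B i)) → ℝ)
    (hw_meas : ∀ j A y, Measurable fun d : (Fin N → Fin p → ℝ) × (Fin N → Fin p → ℝ) =>
      w j A d.1 d.2 y)
    (hw : KnockoffIRT.IsKnockoffStatistic w)
    (W : Ω → Fin p → ℝ)
    (hW : ∀ ω j, W ω j = w j (fun i => A i ω) (fun i => KnockoffIRT.mask (A i ω) (Z i ω))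
      (fun i => KnockoffIRT.mask (A i ω) (Zt i ω)) (fun i => Y i ω))
    (KL : Ω → Fin p → ℝ)
    (hKL : ∀ ω j, KL ω j = KnockoffIRT.klHat P Q s I B (fun i => A i ω) (fun i => Z i ω)
      (fun i => Zt i ω) (fun i => Y i ω) j)
    (ν : ℕ) (hν : 1 ≤ ν) :
    (∀ ε : ℝ, 0 ≤ ε →
      ∫⁻ ω, ({j | j ∈ KnockoffIRT.selected ν (W ω) \ P.nonNull ∧ KL ω j ≤ ε}.ncard : ℝ≥0∞) ∂μ ≤
        ENNReal.ofReal (ν * Real.exp ε)) ∧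
    (Q = P → ∀ j, j ∉ P.nonNull → ∀ ω, KL ω j = 0) := by
  obtain rfl : Z = fun i ω => P.predictors (X i ω) := funext₂ hZ
  obtain rfl : Zt = fun i ω => Q.predictors (Xt i ω) := funext₂ hZt
  have hP (i ω) := P.predictors_mem_values (X i ω)
  have hQ (i ω) := Q.predictors_mem_values (Xt i ω)
  refine ⟨fun ε _ => ?_, ?_⟩
  · refine KnockoffIRT.lintegral_ncard_le_of_lintegral_exp_neg_le ?_ ε
    obtain rfl : W = fun ω => KnockoffIRT.dataStatistics w (KnockoffIRT.sample (A · ω)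
        (fun i => P.predictors (X i ω)) (fun i => Q.predictors (Xt i ω)) (Y · ω)) :=
      funext₂ fun ω j => (hW ω j).trans (KnockoffIRT.dataStatistics_sample _ _ _ _ j).symm
    refine KnockoffIRT.lintegral_sum_exp_neg_le (KnockoffIRT.measurable_sampleDensity P Q s hq_meas)
      (hdata.measurePreserving_sample hq_meas hq) hν KnockoffIRT.measurePreserving_swapSample
      (KnockoffIRT.measurable_dataStatistics hw_meas) (KnockoffIRT.dataStatistics_swapSample hw)
      fun ω j hj => ?_
    rw [hKL]
    exact KnockoffIRT.sampleDensity_sample_eq_exp_klHat_mul hs hq hj _ (hP · ω) (hQ · ω) _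
  · rintro rfl j hj ω
    exact (hKL ω j).trans (KnockoffIRT.klHat_self hs hj (hP · ω) (hQ · ω) _)
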